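/- Let $K$ be a non-archimedean local field (for example a $p$-adic field, $[K:\mathbb{Q}_p]<\infty$), with valuation ring $\mathcal{O}_K$, maximal ideal $\mathcal{P}_K$, residue field of cardinality $q$, normalized valuation $v_K$ and absolute value $|z|_K=q^{-v_K(z)}$; put $\|(z_1,\dots,z_l)\|_K=\max_i|z_i|_K$ on $K^l$, and let $|dx|$ be the Haar measure on $K^n$ for which $\mathcal{O}_K^n$ has measure one. Let $l\ge 1$, let $N_1,\dots,N_l\in\mathbb{N}^n\setminus\{0\}$, $N=(N_1,\dots,N_l)$, $v\in\mathbb{N}^n$, $e_0\in\mathbb{N}$, and let $c_1,\dots,c_l\in\mathcal{O}_K$ be non-zero. For $M\in\mathbb{N}^n$ write $x^M=\prod_j x_j^{M_j}$, and put $$I_{(N,v)}(s)=\int_{(\mathcal{P}_K^{e_0})^n}\left\|\left(c_1x^{N_1},\dots,c_lx^{N_l}\right)\right\|_K^{s}\,|x^v|_K\,|dx|,\qquad \operatorname{Re}(s)>0 .$$ Let $\Gamma(N)\subseteq\mathbb{R}^n$ be the Newton polyhedron of $N$, i.e. the convex hull of $\bigcup_{i}(N_i+\mathbb{R}_{\ge0}^n)$.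 For $a\in\mathbb{R}_{\ge0}^n$ put $m(a)=\inf_{x\in\Gamma(N)}\langle a,x\rangle$ and $\sigma(a)=\sum_j a_j$. For a facet $\gamma$ of $\Gamma(N)$ (a face of dimension $n-1$) let $a(\gamma)$ be the unique vector perpendicular to $\gamma$ whose components are non-negative integers with greatest common divisor one, so that $\gamma=\{x\in\Gamma(N):\langle a(\gamma),x\rangle=m(a(\gamma))\}$. Then the integral $I_{(N,v)}(s)$ converges absolutely for $\operatorname{Re}(s)>0$ and is there equal to a rational function of $q^{-s}$, which gives its meromorphic continuation to $\mathbb{C}$. Every pole of this continuation is of the form $$s=-\frac{\sigma(a(\gamma))+\langle v,a(\gamma)\rangle}{m(a(\gamma))}+\frac{2\pi\sqrt{-1}\,k}{m(a(\gamma))\log q},\qquad k\in\mathbb{Z},$$ for some facet $\gamma$ of $\Gamma(N)$ with $m(a(\gamma))\neq0$. -/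

import Mathlib

open MeasureTheory ValuativeRel

namespace MonomialIntegral

noncomputable section

section LocalField

variable (K : Type*) [Field K] [ValuativeRel K] [TopologicalSpace K]
  [IsNonarchimedeanLocalField K]

/-- The cardinality `q` of the residue field of `K`. -/
def resCard : ℕ := Nat.card 𝓀[K]

variable {K}

/-- The normalized additive valuation `v(z)` of a nonzero `z : K`, with `v(π) = 1` for a
uniformizer `π` (the value at `z = 0` is not used). Mathlib's canonical valuation is
multiplicative, so a uniformizer goes to `exp (-1)` in `ℤᵐ⁰`; hence the sign. -/
def ord (z : K) : ℤ :=
  -WithZero.log (IsNonarchimedeanLocalField.valueGroupWithZeroIsoInt K (valuation K z))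

open Classical in
/-- The normalized absolute value `|z|_K = q ^ (-v(z))`, with `|0|_K = 0`. -/
def absK (z : K) : ℝ := if z = 0 then 0 else (resCard K : ℝ) ^ (-ord z)

/-- The max norm `‖x‖_K = max_i |x_i|_K` on `K ^ l`. -/
def normK {l : ℕ} (x : Fin l → K) : ℝ := ⨆ i, absK (x i)

/-- The monomial `x ^ M = ∏_j x_j ^ M_j`. -/
def monom {n : ℕ} (M : Fin n → ℕ) (x : Fin n → K) : K := ∏ j, x j ^ M j

variable (K) in
/-- The polydisc `(𝒫_K ^ e₀) ^ n` in `K ^ n`, where `𝒫_K` is the maximal ideal of `𝒪_K`. -/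
def polydisc (n e₀ : ℕ) : Set (Fin n → K) :=
  {x | ∀ j, ∃ y : 𝒪[K], y ∈ 𝓂[K] ^ e₀ ∧ (y : K) = x j}

/-- The integrand `‖(c_1 x ^ N_1, …, c_l x ^ N_l)‖_K ^ s * |x ^ v|_K`. -/
def integrand {n l : ℕ} (N : Fin l → Fin n → ℕ) (v : Fin n → ℕ) (c : Fin l → 𝒪[K])
    (s : ℂ) (x : Fin n → K) : ℂ :=
  ((normK fun i => (c i : K) * monom (N i) x : ℝ) : ℂ) ^ s * ((absK (monom v x) : ℝ) : ℂ)

end LocalField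

section Newton

variable {n : ℕ}

/-- The Newton polyhedron `Γ(S)`: the convex hull of `⋃_{m ∈ S} (m + ℝ_{≥0} ^ n)`. -/
def newtonPolyhedron (S : Set (Fin n → ℕ)) : Set (Fin n → ℝ) :=
  convexHull ℝ (⋃ m ∈ S, {x | ∃ y : Fin n → ℝ, (∀ j, 0 ≤ y j) ∧ x = (fun j => (m j : ℝ)) + y})

/-- `m(a) = inf_{x ∈ Γ} ⟨a, x⟩`. -/
def supportMin (Γ : Set (Fin n → ℝ)) (a : Fin n → ℝ) : ℝ :=
  sInf ((fun x => a ⬝ᵥ x) '' Γ)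

/-- A facet of `Γ ⊆ ℝ ^ n`: a (nonempty, exposed) face of dimension `n - 1`. -/
def IsFacet (Γ γ : Set (Fin n → ℝ)) : Prop :=
  IsExposed ℝ Γ γ ∧ γ.Nonempty ∧ Module.finrank ℝ (vectorSpan ℝ γ) + 1 = n

/-- `a` is the primitive vector `a(γ)` of `γ`: its components are nonnegative integers with
greatest common divisor one, and it is perpendicular to `γ`. -/
def IsPrimitiveNormal (γ : Set (Fin n → ℝ)) (a : Fin n → ℕ) : Prop :=
  Finset.univ.gcd a = 1 ∧ ∀ x ∈ γ, ∀ y ∈ γ, (fun j => (a j : ℝ)) ⬝ᵥ (x - y) = 0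

end Newton

/-- `f` has a pole at `s`. -/
def IsPole (f : ℂ → ℂ) (s : ℂ) : Prop := MeromorphicAt f s ∧ meromorphicOrderAt f s < 0

end

end MonomialIntegral

/-! Up to a null set the polydisc is the disjoint union of the sets where every `ord (x j)` is
prescribed. The integrand is constant on each of them, so with `Q = q⁻¹` and `T = q ^ (-s)` the
integral becomes a sum over `k ∈ ℕ ^ n` (`integral_polydisc`). Sorting the `k` by the first index
`i` at which `c i * x ^ N i` has least valuation cuts `ℕ ^ n` into the lattice points of `l`
rational polyhedra (`piece`); on the `i`-th one the summand is a constant times `∏ j, w j ^ k j`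
with `w j = Q ^ (v j + 1) * T ^ N i j`.

The generating series of the lattice points of such a polyhedron is a polynomial divided by a
product of factors `1 - w ^ a`, where each `a` is the primitive generator of an extremal ray of the
recession cone (`exists_polynomial_latticePoints`). No triangulation is needed. A Gordan-type
argument writes the lattice points as a finite set plus the `ℕ`-span of the rays. Among the several
representations of a point the one with lexicographically least coefficients is kept; the discarded
coefficient vectors form an upper set, and Dickson's lemma makes the series of its complement
rational.

The recession cone of the `i`-th piece is the normal cone of the Newton polyhedron at `N i`. Its
rays are the primitive normals of facets through `N i`, and `m(a) = ⟨N i, a⟩` for them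
(`isFacet_of_isRay`, `supportMin_of_isRay`). A pole thus forces `Q ^ (σ(a) + ⟨v, a⟩) * T ^ m(a) = 1`
for some such `a`, and solving for `s` (`eq_of_inv_pow_mul_cpow_pow_eq_one`) gives the stated form.
-/

namespace MonomialIntegral

/-! ### Monomial weights and their geometric series. -/

/-- The weight `∏ j, w j ^ k j` of the lattice point `k`. -/
noncomputable def wt {ι : Type*} [Fintype ι] (w : ι → ℂ) (k : ι → ℕ) : ℂ := ∏ j, w j ^ k j

section wt
variable {ι : Type*} [Fintype ι]

lemma wt_add (w : ι → ℂ) (k k' : ι → ℕ) : wt w (k + k') = wt w k * wt w k' := by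
  simp [wt, pow_add, Finset.prod_mul_distrib]

lemma wt_nsmul (w : ι → ℂ) (c : ℕ) (k : ι → ℕ) : wt w (c • k) = wt w k ^ c := by
  simp [wt, ← Finset.prod_pow, ← pow_mul, mul_comm]

lemma wt_sum {κ : Type*} (t : Finset κ) (w : ι → ℂ) (k : κ → ι → ℕ) :
    wt w (∑ r ∈ t, k r) = ∏ r ∈ t, wt w (k r) := by
  classical
  induction t using Finset.induction_on with
  | empty => simp [wt]
  | insert a s ha ih => rw [Finset.sum_insert ha, Finset.prod_insert ha, wt_add, ih]

lemma wt_single [DecidableEq ι] (w : ι → ℂ) (r : ι) : wt w (Pi.single r 1) = w r := by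
  rw [wt, Finset.prod_eq_single r] <;> simp +contextual

lemma norm_wt_lt_one {w : ι → ℂ} (hw : ∀ j, ‖w j‖ < 1) {a : ι → ℕ} (ha : a ≠ 0) :
    ‖wt w a‖ < 1 := by
  classical
  obtain ⟨j, hj⟩ := Function.ne_iff.1 ha
  rw [wt, norm_prod, ← Finset.mul_prod_erase _ _ (Finset.mem_univ j)]
  have h1 : ‖w j ^ a j‖ < 1 := by
    rw [norm_pow]; exact pow_lt_one₀ (norm_nonneg _) (hw j) hj
  have h2 : ∏ i ∈ Finset.univ.erase j, ‖w i ^ a i‖ ≤ 1 := by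
    refine Finset.prod_le_one (fun _ _ => norm_nonneg _) fun i _ => ?_
    rw [norm_pow]; exact pow_le_one₀ (norm_nonneg _) (hw i).le
  nlinarith [norm_nonneg (w j ^ a j), Finset.prod_nonneg (s := Finset.univ.erase j)
    (fun i _ => norm_nonneg (w i ^ a i))]

/-- The monomial whose evaluation at `w` is `wt w k`. -/
lemma exists_eval_eq_wt (k : ι → ℕ) :
    ∃ p : MvPolynomial ι ℂ, ∀ w, MvPolynomial.eval w p = wt w k :=
  ⟨∏ j, MvPolynomial.X j ^ k j, fun w => by simp [wt]⟩

end wt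

lemma summable_norm_wt_fin {n : ℕ} (w : Fin n → ℂ) (hw : ∀ j, ‖w j‖ < 1) :
    Summable fun k : Fin n → ℕ => ‖wt w k‖ := by
  induction n with
  | zero => exact (hasSum_fintype _).summable
  | succ n ih =>
    have h0 : Summable fun k : ℕ => ‖w 0 ^ k‖ := by
      simpa using summable_geometric_of_lt_one (norm_nonneg _) (hw 0)
    have h1 := ih (Fin.tail w) fun j => hw _
    have h2 := h0.mul_of_nonneg h1 (fun _ => norm_nonneg _) fun _ => norm_nonneg _
    rw [← (Fin.consEquiv fun _ : Fin (n + 1) => ℕ).summable_iff]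
    refine h2.congr fun x => ?_
    simp [wt, Fin.consEquiv, Fin.prod_univ_succ, Fin.tail]

lemma summable_norm_wt {ι : Type*} [Fintype ι] (w : ι → ℂ) (hw : ∀ j, ‖w j‖ < 1) :
    Summable fun k : ι → ℕ => ‖wt w k‖ := by
  have e := Fintype.equivFin ι
  have h := summable_norm_wt_fin (w ∘ e.symm) fun j => hw _
  rw [← (Equiv.arrowCongr e (Equiv.refl ℕ)).summable_iff] at h
  refine h.congr fun k => ?_
  simp only [wt, Function.comp_apply, Equiv.arrowCongr_apply, Equiv.coe_refl, id]
  rw [← e.symm.prod_comp]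

/-! ### Dickson's lemma. -/

section Dickson
variable {ι : Type*} [Fintype ι]

/-- Dickson's lemma: membership in an upper set of `ℕ ^ ι` only depends on the truncation of the
coordinates at some bound. -/
lemma exists_bound_of_isUpperSet {U : Set (ι → ℕ)} (hU : IsUpperSet U) :
    ∃ B : ℕ, ∀ x, x ∈ U ↔ (fun r => min (x r) B) ∈ U := by
  have hfin : {x | Minimal (· ∈ U) x}.Finite :=
    WellQuasiOrderedLE.finite_of_isAntichain (setOfPred_minimal_antichain _)
  obtain ⟨B, hB⟩ : ∃ B : ℕ, ∀ x ∈ {x | Minimal (· ∈ U) x}, ∀ r, x r ≤ B := by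
    refine ⟨∑ x ∈ hfin.toFinset, ∑ r, x r, fun x hx r => ?_⟩
    exact (Finset.single_le_sum (f := x) (fun _ _ => Nat.zero_le _) (Finset.mem_univ r)).trans
      (Finset.single_le_sum (f := fun x : ι → ℕ => ∑ r, x r) (fun _ _ => Nat.zero_le _)
        (hfin.mem_toFinset.2 hx))
  refine ⟨B, fun x => ⟨fun hx => ?_, fun hx => hU (fun r => min_le_left _ _) hx⟩⟩
  obtain ⟨m, hmx, hm⟩ := exists_minimal_le_of_wellFoundedLT (· ∈ U) x hx
  exact hU (fun r => le_min (hmx r) (hB m hm r)) hm.1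

end Dickson

/-! ### Rationality by iterated differences. -/

section Difference
variable {ι : Type*} [Fintype ι] [DecidableEq ι]

/-- The backward difference of `f` in the direction `r`. -/
def bdiff (r : ι) (f : (ι → ℕ) → ℂ) (x : ι → ℕ) : ℂ :=
  f x - if x r = 0 then 0 else f (x - Pi.single r 1)

omit [Fintype ι] in
lemma norm_bdiff_le (r : ι) {f : (ι → ℕ) → ℂ} {C : ℝ} (hf : ∀ x, ‖f x‖ ≤ C) (x : ι → ℕ) :
    ‖bdiff r f x‖ ≤ C + C := by
  refine (norm_sub_le _ _).trans (add_le_add (hf x) ?_)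
  split_ifs
  · simpa using (norm_nonneg _).trans (hf x)
  · exact hf _

omit [DecidableEq ι] in
lemma summable_mul_wt {f : (ι → ℕ) → ℂ} {C : ℝ} (hf : ∀ x, ‖f x‖ ≤ C) {w : ι → ℂ}
    (hw : ∀ j, ‖w j‖ < 1) : Summable fun x => f x * wt w x := by
  refine Summable.of_norm_bounded ((summable_norm_wt w hw).mul_left C) fun x => ?_
  rw [norm_mul]
  exact mul_le_mul_of_nonneg_right (hf x) (norm_nonneg _)

/-- Multiplying the series by `w r` shifts `f` by one step in direction `r`; the points with `x r =
0` are missed by the shift and get coefficient zero. -/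
lemma tsum_bdiff (r : ι) {f : (ι → ℕ) → ℂ} {C : ℝ} (hf : ∀ x, ‖f x‖ ≤ C) {w : ι → ℂ}
    (hw : ∀ j, ‖w j‖ < 1) :
    ∑' x, bdiff r f x * wt w x = (∑' x, f x * wt w x) * (1 - w r) := by
  have h1 := summable_mul_wt hf hw
  have h2 : HasSum (fun x => (if x r = 0 then 0 else f (x - Pi.single r 1)) * wt w x)
      ((∑' x, f x * wt w x) * w r) := by
    have hinj : Function.Injective fun x : ι → ℕ => x + Pi.single r 1 := add_left_injective _
    rw [← hinj.hasSum_iff]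
    · have h3 := h1.hasSum.mul_right (w r)
      refine h3.congr_fun fun x => ?_
      simp [wt_add, wt_single, mul_assoc]
    · intro x hx
      have : x r = 0 := by
        by_contra h
        refine hx ⟨x - Pi.single r 1, ?_⟩
        ext i
        by_cases hi : i = r
        · subst hi; simp; omega
        · simp [hi]
      simp [this]
  rw [mul_sub, mul_one, ← h2.tsum_eq, ← h1.tsum_sub h2.summable]
  simp only [bdiff, sub_mul]

omit [Fintype ι] in
lemma add_single_sub_single {r r' : ι} {x : ι → ℕ} (hx : x r ≠ 0) :
    x + Pi.single r' 1 - Pi.single r 1 = x - Pi.single r 1 + Pi.single r' 1 := by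
  ext i
  have : Pi.single (M := fun _ => ℕ) r 1 i ≤ x i := by
    by_cases hi : i = r
    · subst hi; simp; omega
    · simp [hi]
  simp only [Pi.sub_apply, Pi.add_apply]
  omega

-- The inequality is strict because the difference compares `x` with its predecessor, which must
-- still have `r`-th coordinate at least `B`.
omit [Fintype ι] in
lemma bdiff_eq_zero {r : ι} {f : (ι → ℕ) → ℂ} {B : ℕ}
    (hf : ∀ x, B ≤ x r → f (x + Pi.single r 1) = f x) {x : ι → ℕ} (hx : B < x r) :
    bdiff r f x = 0 := by
  have h := hf (x - Pi.single r 1) (by simp; omega)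
  rw [← add_single_sub_single (by omega), add_tsub_cancel_right] at h
  simp [bdiff, h, show x r ≠ 0 by omega]

omit [Fintype ι] in
lemma bdiff_add_single {r r' : ι} (hr : r ≠ r') {f : (ι → ℕ) → ℂ} {B : ℕ}
    (hf : ∀ x, B ≤ x r' → f (x + Pi.single r' 1) = f x) {x : ι → ℕ} (hx : B ≤ x r') :
    bdiff r f (x + Pi.single r' 1) = bdiff r f x := by
  have h1 : (x + Pi.single r' 1 : ι → ℕ) r = x r := by simp [hr]
  simp only [bdiff, h1, hf x hx]
  split_ifs with h0
  · rfl
  · rw [add_single_sub_single h0, hf _ (by simpa [hr.symm] using hx)]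

/-- The generating series of a bounded function which is constant in each coordinate direction from
`B` on is a polynomial divided by `∏ r, (1 - w r)`. -/
lemma exists_polynomial_of_stable {f : (ι → ℕ) → ℂ} {C : ℝ} (hC : ∀ x, ‖f x‖ ≤ C) {B : ℕ}
    (hf : ∀ r x, B ≤ x r → f (x + Pi.single r 1) = f x) :
    ∃ p : MvPolynomial ι ℂ, ∀ w : ι → ℂ, (∀ j, ‖w j‖ < 1) →
      (∑' x, f x * wt w x) * ∏ r, (1 - w r) = MvPolynomial.eval w p := by
  -- Induction on the set `t` of directions already differenced: these bound the support, and the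
  -- remaining directions keep their stability.
  have key : ∀ t : Finset ι, ∃ (g : (ι → ℕ) → ℂ) (C' : ℝ), (∀ x, ‖g x‖ ≤ C') ∧
      (∀ r ∈ t, ∀ x, B < x r → g x = 0) ∧
      (∀ r ∉ t, ∀ x, B ≤ x r → g (x + Pi.single r 1) = g x) ∧
      ∀ w : ι → ℂ, (∀ j, ‖w j‖ < 1) →
        (∑' x, f x * wt w x) * ∏ r ∈ t, (1 - w r) = ∑' x, g x * wt w x := by
    intro t
    induction t using Finset.induction_on with
    | empty => exact ⟨f, C, hC, by simp, fun r _ => hf r, by simp⟩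
    | insert r t hr ih =>
      obtain ⟨g, C', h1, h2, h3, h4⟩ := ih
      refine ⟨bdiff r g, C' + C', norm_bdiff_le r h1, ?_, ?_, ?_⟩
      · intro r' hr' x hx
        rcases eq_or_ne r' r with rfl | hne
        · exact bdiff_eq_zero (h3 r' hr) hx
        · have hr't := Finset.mem_of_mem_insert_of_ne hr' hne
          simp only [bdiff, h2 r' hr't x hx, zero_sub, neg_eq_zero, ite_eq_left_iff]
          exact fun _ => h2 r' hr't _ (by simpa [hne] using hx)
      · intro r' hr' x hx
        rw [Finset.mem_insert, not_or] at hr'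
        exact bdiff_add_single (Ne.symm hr'.1) (h3 r' hr'.2) hx
      · intro w hw
        rw [tsum_bdiff r h1 hw, ← h4 w hw, Finset.prod_insert hr]
        ring
  obtain ⟨g, C', h1, h2, h3, h4⟩ := key Finset.univ
  choose p hp using exists_eval_eq_wt (ι := ι)
  refine ⟨∑ x ∈ Finset.Iic (fun _ => B), MvPolynomial.C (g x) * p x, fun w hw => ?_⟩
  rw [h4 w hw, tsum_eq_sum (s := Finset.Iic (fun _ => B))]
  · simp [hp]
  · intro x hx
    simp only [Finset.mem_Iic, Pi.le_def, not_forall, not_le] at hx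
    obtain ⟨r, hr⟩ := hx
    rw [h2 r (Finset.mem_univ _) x hr, zero_mul]

end Difference

-- By Dickson's lemma the indicator of the complement is constant in each direction from some bound
-- on.
open Classical in
lemma exists_polynomial_of_isUpperSet {ι : Type*} [Fintype ι] {U : Set (ι → ℕ)}
    (hU : IsUpperSet U) :
    ∃ p : MvPolynomial ι ℂ, ∀ w : ι → ℂ, (∀ j, ‖w j‖ < 1) →
      (∑' x, Uᶜ.indicator (wt w) x) * ∏ r, (1 - w r) = MvPolynomial.eval w p := by
  obtain ⟨B, hB⟩ := exists_bound_of_isUpperSet hU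
  obtain ⟨p, hp⟩ := exists_polynomial_of_stable (f := Uᶜ.indicator 1) (C := 1) (B := B)
    (fun x => by by_cases hx : x ∈ U <;> simp [hx]) (fun r x hx => by
      have h : x + Pi.single r 1 ∈ U ↔ x ∈ U := by
        rw [hB, hB x]
        have : (fun i => min ((x + Pi.single r 1 : ι → ℕ) i) B) = fun i => min (x i) B := by
          ext i
          by_cases hi : i = r
          · subst hi; simp; omega
          · simp [hi]
        rw [this]
      simp [Set.indicator, h])
  refine ⟨p, fun w hw => ?_⟩
  rw [← hp w hw]
  congr 2
  ext x
  by_cases hx : x ∈ U <;> simp [hx]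

/-! ### Finitely generated sets of lattice points. -/

section Module
variable {n R : ℕ}

/-- The set `E + ∑ r, ℕ a r` of lattice points. -/
def genSet (E : Finset (Fin n → ℕ)) (a : Fin R → Fin n → ℕ) : Set (Fin n → ℕ) :=
  {k | ∃ e ∈ E, ∃ c : Fin R → ℕ, k = e + ∑ r, c r • a r}

/-- The coefficient vectors `c` for which `e + ∑ r, c r • a r` has a representation with
lexicographically smaller coefficients. -/
def reducible (E : Finset (Fin n → ℕ)) (a : Fin R → Fin n → ℕ) (e : Fin n → ℕ) :
    Set (Fin R → ℕ) :=
  {c | ∃ e' ∈ E, ∃ c' : Fin R → ℕ, toLex c' < toLex c ∧ e' + ∑ r, c' r • a r = e + ∑ r, c r • a r}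

/-- Adding a common vector to both coefficient vectors preserves the lexicographic inequality and
the equality of the represented points. -/
lemma isUpperSet_reducible (E : Finset (Fin n → ℕ)) (a : Fin R → Fin n → ℕ) (e : Fin n → ℕ) :
    IsUpperSet (reducible E a e) := by
  rintro c d hcd ⟨e', he', c', hlt, heq⟩
  obtain ⟨m, rfl⟩ := exists_add_of_le hcd
  refine ⟨e', he', c' + m, ?_, ?_⟩
  · rw [toLex_add, toLex_add]
    exact add_lt_add_left hlt _
  · simp only [Pi.add_apply, add_smul, Finset.sum_add_distrib, ← add_assoc, heq]

/-- Each point has exactly one representation with irreducible coefficients: lexicographic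
minimality fixes `c`, and cancellation then fixes `e`. -/
lemma tsum_genSet (E : Finset (Fin n → ℕ)) (a : Fin R → Fin n → ℕ) (ha : ∀ r, a r ≠ 0)
    {w : Fin n → ℂ} (hw : ∀ j, ‖w j‖ < 1) :
    ∑' k : genSet E a, wt w k =
      ∑ e ∈ E, wt w e * ∑' c, (reducible E a e)ᶜ.indicator (wt fun r => wt w (a r)) c := by
  let D : Set (E × (Fin R → ℕ)) := {p | p.2 ∉ reducible E a p.1}
  let F : D → genSet E a := fun p =>
    ⟨p.1.1 + ∑ r, p.1.2 r • a r, p.1.1, p.1.1.2, p.1.2, rfl⟩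
  have hF : Function.Bijective F := by
    constructor
    · rintro ⟨⟨⟨e, he⟩, c⟩, h⟩ ⟨⟨⟨e', he'⟩, c'⟩, h'⟩ heq
      simp only [F, Subtype.mk.injEq] at heq
      have hc : c = c' := by
        rcases lt_trichotomy (toLex c) (toLex c') with hlt | h0 | hlt
        · exact absurd ⟨e, he, c, hlt, heq⟩ h'
        · exact toLex.injective h0
        · exact absurd ⟨e', he', c', hlt, heq.symm⟩ h
      subst hc
      have := add_right_cancel heq
      subst this
      rfl
    · rintro ⟨k, hk⟩
      let P : Set (Lex (Fin R → ℕ)) := {c | ∃ e ∈ E, k = e + ∑ r, (ofLex c) r • a r}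
      have hP : P.Nonempty := by
        obtain ⟨e, he, c, h⟩ := hk
        exact ⟨toLex c, e, he, h⟩
      obtain ⟨e, he, hmin⟩ := WellFounded.min_mem wellFounded_lt P hP
      refine ⟨⟨⟨⟨e, he⟩, ofLex (WellFounded.min wellFounded_lt P hP)⟩, ?_⟩, ?_⟩
      · rintro ⟨e', he', c', hlt, heq⟩
        exact WellFounded.not_lt_min wellFounded_lt P (x := toLex c') ⟨e', he', by
          rw [hmin]; exact heq.symm⟩ hlt
      · exact Subtype.ext hmin.symm
  have hy : ∀ r, ‖wt w (a r)‖ < 1 := fun r => norm_wt_lt_one hw (ha r)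
  have hwt : ∀ (e : Fin n → ℕ) (c : Fin R → ℕ),
      wt w (e + ∑ r, c r • a r) = wt w e * wt (fun r => wt w (a r)) c := by
    intro e c
    rw [wt_add, wt_sum]
    simp only [wt_nsmul]
    rfl
  have hsum : Summable fun p : E × (Fin R → ℕ) =>
      D.indicator (fun p => wt w (p.1 + ∑ r, p.2 r • a r)) p := by
    refine Summable.indicator ?_ _
    simp only [hwt]
    have h1 : Summable fun e : E => ‖wt w e‖ := (hasSum_fintype _).summable
    exact summable_mul_of_summable_norm (f := fun e : E => wt w e)
      (g := wt fun r => wt w (a r)) h1 (summable_norm_wt _ hy)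
  rw [← (Equiv.ofBijective F hF).tsum_eq]
  have h1 : ∑' p : D, wt w (Equiv.ofBijective F hF p) =
      ∑' p, D.indicator (fun p => wt w (p.1 + ∑ r, p.2 r • a r)) p :=
    tsum_subtype D fun p : E × (Fin R → ℕ) => wt w (p.1 + ∑ r, p.2 r • a r)
  rw [h1, hsum.tsum_prod, tsum_fintype, ← Finset.sum_coe_sort E]
  refine Finset.sum_congr rfl fun e _ => ?_
  rw [← tsum_mul_left]
  refine tsum_congr fun c => ?_
  by_cases hc : c ∈ reducible E a e
  · simp [Set.indicator, D, hc]
  · simpa [Set.indicator, D, hc] using hwt e c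

/-- The generating series of `E + ∑ r, ℕ a r` is a polynomial divided by `∏ r, (1 - w ^ a r)`. -/
theorem exists_polynomial_genSet (E : Finset (Fin n → ℕ)) (a : Fin R → Fin n → ℕ)
    (ha : ∀ r, a r ≠ 0) :
    ∃ p : MvPolynomial (Fin n) ℂ, ∀ w : Fin n → ℂ, (∀ j, ‖w j‖ < 1) →
      (∑' k : genSet E a, wt w k) * ∏ r, (1 - wt w (a r)) = MvPolynomial.eval w p := by
  choose p hp using fun e => exists_polynomial_of_isUpperSet (isUpperSet_reducible E a e)
  choose m hm using exists_eval_eq_wt (ι := Fin n)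
  refine ⟨∑ e ∈ E, m e * MvPolynomial.bind₁ (fun r => m (a r)) (p e), fun w hw => ?_⟩
  rw [tsum_genSet E a ha hw, Finset.sum_mul, map_sum]
  refine Finset.sum_congr rfl fun e _ => ?_
  rw [mul_assoc, hp e _ fun r => norm_wt_lt_one hw (ha r), map_mul, hm]
  congr 1
  rw [← MvPolynomial.coe_aeval_eq_eval, ← MvPolynomial.coe_aeval_eq_eval]
  simp only [RingHom.coe_coe, MvPolynomial.aeval_bind₁]
  congr 2
  ext r
  rw [← hm, ← MvPolynomial.coe_aeval_eq_eval]
  rfl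

end Module

/-! ### Extremal rays and lattice points of rational polyhedra. -/

section Cone
variable {n : ℕ} {ι : Type*}

/-- `a` is the primitive generator of an extremal ray of the cone
`{x | 0 ≤ x ∧ ∀ i, 0 ≤ ⟨b i, x⟩}`: the constraints active at `a` determine `a` up to scaling. -/
structure IsRay (b : ι → Fin n → ℤ) (a : Fin n → ℕ) : Prop where
  gcd_eq_one : Finset.univ.gcd a = 1
  mem : ∀ i, 0 ≤ ∑ j, b i j * (a j : ℤ)
  ker : ∀ u : Fin n → ℝ, (∀ j, a j = 0 → u j = 0) →
    (∀ i, ∑ j, b i j * (a j : ℤ) = 0 → ∑ j, (b i j : ℝ) * u j = 0) → ∃ t : ℝ, ∀ j, u j = t * a j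

lemma ne_zero_of_gcd_eq_one {a : Fin n → ℕ} (ha : Finset.univ.gcd a = 1) : a ≠ 0 := by
  rintro rfl
  have : Finset.univ.gcd (0 : Fin n → ℕ) = 0 := Finset.gcd_eq_zero_iff.2 fun _ _ => rfl
  omega

lemma eq_of_gcd_eq_one_of_proportional {a a' : Fin n → ℕ} (ha : Finset.univ.gcd a = 1)
    (ha' : Finset.univ.gcd a' = 1) {t : ℝ} (h : ∀ j, (a' j : ℝ) = t * a j) : a' = a := by
  obtain ⟨j, hj⟩ := Function.ne_iff.1 (ne_zero_of_gcd_eq_one ha)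
  have hcross : ∀ i, a' i * a j = a i * a' j := by
    intro i
    have : (a' i : ℝ) * a j = a i * a' j := by rw [h i, h j]; ring
    exact_mod_cast this
  have h1 : a j = a' j := by
    have h2 : Finset.univ.gcd (fun i => a' i * a j) = Finset.univ.gcd (fun i => a i * a' j) := by
      simp only [hcross]
    rw [Finset.gcd_mul_right, Finset.gcd_mul_right] at h2
    simpa [ha, ha'] using h2
  ext i
  have := hcross i
  rw [← h1] at this
  exact Nat.eq_of_mul_eq_mul_right (Nat.pos_of_ne_zero hj) this

/-- A primitive ray generator is determined by its set of active constraints, and there are finitely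
many such sets. -/
lemma finite_isRay [Finite ι] (b : ι → Fin n → ℤ) : {a | IsRay b a}.Finite := by
  refine Set.Finite.of_finite_image (f := fun a : Fin n → ℕ =>
    (({j | a j = 0}, {i | ∑ j, b i j * (a j : ℤ) = 0}) : Set (Fin n) × Set ι)) (Set.toFinite _) ?_
  intro a ha a' ha' h
  simp only [Prod.mk.injEq, Set.ext_iff, Set.mem_ofPred_eq] at h
  obtain ⟨t, ht⟩ := IsRay.ker ha (fun j => a' j) (fun j hj => by simpa using (h.1 j).1 hj)
    (fun i hi => by exact_mod_cast (h.2 i).1 hi)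
  exact (eq_of_gcd_eq_one_of_proportional ha.gcd_eq_one ha'.gcd_eq_one ht).symm

/-- The slice `∑ j, x j = 1` of the cone `{x | 0 ≤ x ∧ ∀ i, 0 ≤ ⟨b i, x⟩}`. -/
def coneSlice (b : ι → Fin n → ℤ) : Set (Fin n → ℝ) :=
  {x | (∀ j, 0 ≤ x j) ∧ (∀ i, 0 ≤ ∑ j, (b i j : ℝ) * x j) ∧ ∑ j, x j = 1}

lemma convex_coneSlice (b : ι → Fin n → ℤ) : Convex ℝ (coneSlice b) := by
  rintro x ⟨hx1, hx2, hx3⟩ y ⟨hy1, hy2, hy3⟩ s t hs ht hst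
  refine ⟨fun j => ?_, fun i => ?_, ?_⟩
  · have := hx1 j; have := hy1 j
    simp only [Pi.add_apply, Pi.smul_apply, smul_eq_mul]
    positivity
  · have h : ∑ j, (b i j : ℝ) * (s • x + t • y) j
        = s * ∑ j, (b i j : ℝ) * x j + t * ∑ j, (b i j : ℝ) * y j := by
      simp only [Finset.mul_sum, ← Finset.sum_add_distrib]
      refine Finset.sum_congr rfl fun j _ => ?_
      simp only [Pi.add_apply, Pi.smul_apply, smul_eq_mul]
      ring
    rw [h]
    have := hx2 i; have := hy2 i
    positivity
  · simp [Finset.sum_add_distrib, ← Finset.mul_sum, hx3, hy3, hst]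

lemma isCompact_coneSlice (b : ι → Fin n → ℤ) : IsCompact (coneSlice b) := by
  refine (isCompact_Icc (a := (0 : Fin n → ℝ)) (b := 1)).of_isClosed_subset ?_ ?_
  · have : coneSlice b = (⋂ j, {x : Fin n → ℝ | 0 ≤ x j}) ∩
        ((⋂ i, {x : Fin n → ℝ | 0 ≤ ∑ j, (b i j : ℝ) * x j}) ∩ {x | ∑ j, x j = 1}) := by
      ext x; simp [coneSlice]
    rw [this]
    refine (isClosed_iInter fun j => ?_).inter ((isClosed_iInter fun i => ?_).inter ?_)
    · exact isClosed_le continuous_const (by fun_prop)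
    · exact isClosed_le continuous_const (by fun_prop)
    · exact isClosed_eq (by fun_prop) continuous_const
  · rintro x ⟨h1, -, h3⟩
    refine ⟨fun j => h1 j, fun j => ?_⟩
    rw [Pi.one_apply, ← h3]
    exact Finset.single_le_sum (fun i _ => h1 i) (Finset.mem_univ j)

lemma eventually_nonneg_add_mul {α β : ℝ} (hα : 0 ≤ α) (h : α = 0 → β = 0) :
    ∀ᶠ ε in nhds (0 : ℝ), 0 ≤ α + ε * β := by
  rcases hα.eq_or_lt' with h0 | h0
  · simp [h0, h h0]
  · have : Filter.Tendsto (fun ε : ℝ => α + ε * β) (nhds 0) (nhds (α + 0 * β)) :=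
      Continuous.tendsto (by fun_prop) 0
    rw [zero_mul, add_zero] at this
    exact (this.eventually (lt_mem_nhds h0)).mono fun ε h => h.le

/-- Subtracting a multiple of `x` from `u` gives a direction `y` with coordinate sum zero that
preserves the active constraints. Then `x + ε y` and `x - ε y` both lie in the slice for small `ε`,
so extremality forces `y = 0`. -/
lemma ker_of_mem_extremePoints [Finite ι] {b : ι → Fin n → ℤ} {x : Fin n → ℝ}
    (hx : x ∈ (coneSlice b).extremePoints ℝ) {u : Fin n → ℝ} (hu1 : ∀ j, x j = 0 → u j = 0)
    (hu2 : ∀ i, ∑ j, (b i j : ℝ) * x j = 0 → ∑ j, (b i j : ℝ) * u j = 0) :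
    ∀ j, u j = (∑ i, u i) * x j := by
  obtain ⟨⟨h1, h2, h3⟩, hext⟩ := hx
  set y : Fin n → ℝ := fun j => u j - (∑ i, u i) * x j with hy
  have hby : ∀ i, ∑ j, (b i j : ℝ) * y j
      = ∑ j, (b i j : ℝ) * u j - (∑ i, u i) * ∑ j, (b i j : ℝ) * x j := by
    intro i
    rw [Finset.mul_sum, ← Finset.sum_sub_distrib]
    exact Finset.sum_congr rfl fun j _ => by simp only [hy]; ring
  have hy0 : ∑ j, y j = 0 := by
    simp [hy, Finset.sum_sub_distrib, ← Finset.mul_sum, h3]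
  have hmem : ∀ᶠ ε in nhds (0 : ℝ), x + ε • y ∈ coneSlice b := by
    have e1 : ∀ᶠ ε in nhds (0 : ℝ), ∀ j, 0 ≤ x j + ε * y j :=
      Filter.eventually_all.2 fun j => eventually_nonneg_add_mul (h1 j) fun h => by
        simp [hy, h, hu1 j h]
    have e2 : ∀ᶠ ε in nhds (0 : ℝ), ∀ i,
        0 ≤ ∑ j, (b i j : ℝ) * x j + ε * ∑ j, (b i j : ℝ) * y j :=
      Filter.eventually_all.2 fun i => eventually_nonneg_add_mul (h2 i) fun h => by
        simp [hby, h, hu2 i h]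
    filter_upwards [e1, e2] with ε h1' h2'
    refine ⟨fun j => by simpa using h1' j, fun i => ?_, ?_⟩
    · convert h2' i using 1
      rw [Finset.mul_sum, ← Finset.sum_add_distrib]
      exact Finset.sum_congr rfl fun j _ => by
        simp only [Pi.add_apply, Pi.smul_apply, smul_eq_mul]; ring
    · simp [Finset.sum_add_distrib, ← Finset.mul_sum, h3, hy0]
  have hmem' : ∀ᶠ ε in nhds (0 : ℝ), x + (-ε) • y ∈ coneSlice b := by
    have : Filter.Tendsto (fun ε : ℝ => -ε) (nhds 0) (nhds 0) := by
      simpa using (continuous_neg (G := ℝ)).tendsto 0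
    exact this.eventually hmem
  obtain ⟨ε, ⟨hε1, hε2⟩, hε0⟩ := (((hmem.and hmem').filter_mono nhdsWithin_le_nhds).and
    (self_mem_nhdsWithin : {(0 : ℝ)}ᶜ ∈ nhdsWithin 0 {0}ᶜ)).exists
  have hseg : x ∈ openSegment ℝ (x + ε • y) (x + (-ε) • y) := by
    refine ⟨1 / 2, 1 / 2, by norm_num, by norm_num, by norm_num, ?_⟩
    ext j
    simp only [Pi.add_apply, Pi.smul_apply, smul_eq_mul]
    ring
  have h4 := hext hε1 hε2 hseg
  intro j
  have h5 := congrFun h4 j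
  simp only [Pi.add_apply, Pi.smul_apply, smul_eq_mul, add_eq_left, mul_eq_zero] at h5
  have := h5.resolve_left hε0
  simp only [hy] at this
  linarith

/-- A nonnegative rational vector is a positive multiple of a primitive vector. -/
lemma exists_primitive_of_rat {y : Fin n → ℚ} (hy : ∀ j, 0 ≤ y j) (hy0 : y ≠ 0) :
    ∃ (a : Fin n → ℕ) (t : ℚ), 0 < t ∧ Finset.univ.gcd a = 1 ∧ ∀ j, y j = t * a j := by
  obtain ⟨j₀, hj₀⟩ := Function.ne_iff.1 hy0
  -- Denominators are cleared with the product of all of them; the gcd is divided out afterwards.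
  have hz : ∀ j, ∃ z : ℕ, (z : ℚ) = y j * ∏ i, ((y i).den : ℚ) := by
    intro j
    refine ⟨(y j).num.toNat * ∏ i ∈ Finset.univ.erase j, (y i).den, ?_⟩
    rw [← Finset.mul_prod_erase _ _ (Finset.mem_univ j), ← mul_assoc, Rat.mul_den_eq_num]
    push_cast
    congr 1
    have := Int.toNat_of_nonneg (Rat.num_nonneg.2 (hy j))
    exact_mod_cast this
  choose z hz using hz
  have hD : (0 : ℚ) < ∏ i, ((y i).den : ℚ) :=
    Finset.prod_pos fun i _ => by exact_mod_cast (y i).den_pos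
  have hzj : z j₀ ≠ 0 := by
    intro h
    have := hz j₀
    rw [h, Nat.cast_zero, eq_comm, mul_eq_zero] at this
    exact this.elim hj₀ hD.ne'
  obtain ⟨a, ha, hg⟩ := Finset.extract_gcd z (Finset.univ_nonempty_iff.2 ⟨j₀⟩)
  have hgpos : 0 < Finset.univ.gcd z := Nat.pos_of_ne_zero fun h =>
    hzj (Finset.gcd_eq_zero_iff.1 h j₀ (Finset.mem_univ _))
  refine ⟨a, (Finset.univ.gcd z : ℕ) / ∏ i, ((y i).den : ℚ), by positivity, hg, fun j => ?_⟩
  have h1 := hz j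
  rw [ha j (Finset.mem_univ j)] at h1
  push_cast at h1
  field_simp
  linarith

/-- Rationality comes from a `ℚ`-linear functional `f : ℝ → ℚ`. The constraints have integer
coefficients, so applying `f` to each coordinate of `x` preserves the active ones; by extremality
the resulting rational vector is proportional to `x`. -/
lemma exists_isRay_of_mem_extremePoints [Finite ι] {b : ι → Fin n → ℤ} {x : Fin n → ℝ}
    (hx : x ∈ (coneSlice b).extremePoints ℝ) :
    ∃ (a : Fin n → ℕ) (t : ℝ), IsRay b a ∧ 0 ≤ t ∧ ∀ j, x j = t * a j := by
  obtain ⟨h1, h2, h3⟩ := hx.1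
  obtain ⟨j₀, hj₀⟩ : ∃ j, x j ≠ 0 := by
    by_contra! h
    simp [h] at h3
  obtain ⟨f, hf⟩ : ∃ f : Module.Dual ℚ ℝ, f (x j₀) ≠ 0 := by
    by_contra! h
    exact hj₀ ((Module.forall_dual_apply_eq_zero_iff ℚ (x j₀)).1 h)
  have hker := ker_of_mem_extremePoints hx (u := fun j => (f (x j) : ℝ))
    (fun j hj => by simp [hj]) (fun i hi => by
      have h := congrArg f hi
      rw [map_sum, map_zero] at h
      have h' : ∀ j, f ((b i j : ℝ) * x j) = (b i j : ℚ) * f (x j) := fun j => by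
        rw [← zsmul_eq_mul, map_zsmul, zsmul_eq_mul]
      simp only [h'] at h
      exact_mod_cast h)
  set c : ℝ := ∑ i, (f (x i) : ℝ)
  have hc : c ≠ 0 := by
    intro h
    have := hker j₀
    rw [h, zero_mul] at this
    exact hf (by exact_mod_cast this)
  -- The sign of the factor `c` is unknown, hence the absolute values; they do no harm because `0 ≤
  -- x j`.
  obtain ⟨a, t, ht, hgcd, ha⟩ := exists_primitive_of_rat (y := fun j => |f (x j)|)
    (fun j => abs_nonneg _) (Function.ne_iff.2 ⟨j₀, by simpa using hf⟩)
  have hxa : ∀ j, x j = (t / |c|) * a j := by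
    intro j
    have e1 : (t : ℝ) * a j = |c| * x j := by
      rw [← abs_of_nonneg (h1 j), ← abs_mul, ← hker j]
      exact_mod_cast (ha j).symm
    have : |c| ≠ 0 := abs_ne_zero.2 hc
    field_simp
    linarith
  have htc : 0 < (t : ℝ) / |c| := div_pos (by exact_mod_cast ht) (abs_pos.2 hc)
  have hba : ∀ i, ∑ j, (b i j : ℝ) * x j = (t / |c|) * ((∑ j, b i j * (a j : ℤ) : ℤ) : ℝ) := by
    intro i
    push_cast
    rw [Finset.mul_sum]
    exact Finset.sum_congr rfl fun j _ => by rw [hxa j]; ring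
  refine ⟨a, t / |c|, ⟨hgcd, fun i => ?_, fun u hu1 hu2 => ?_⟩, htc.le, hxa⟩
  · have := h2 i
    rw [hba, mul_nonneg_iff_of_pos_left htc] at this
    exact_mod_cast this
  · have := ker_of_mem_extremePoints hx (u := u)
      (fun j hj => hu1 j (by
        rw [hxa, mul_eq_zero] at hj
        exact_mod_cast hj.resolve_left htc.ne'))
      (fun i hi => hu2 i (by
        rw [hba, mul_eq_zero] at hi
        exact_mod_cast hi.resolve_left htc.ne'))
    exact ⟨(∑ i, u i) * (t / |c|), fun j => by rw [this j, hxa j]; ring⟩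

/-- The cone `{x | 0 ≤ x ∧ ∀ i, 0 ≤ ⟨b i, x⟩}` is generated by its extremal rays. -/
lemma exists_nonneg_combination [Finite ι] {b : ι → Fin n → ℤ} {x : Fin n → ℝ}
    (hx : ∀ j, 0 ≤ x j) (hbx : ∀ i, 0 ≤ ∑ j, (b i j : ℝ) * x j) :
    ∃ c : (Fin n → ℕ) → ℝ, (∀ a, 0 ≤ c a) ∧
      ∀ j, x j = ∑ a ∈ (finite_isRay b).toFinset, c a * a j := by
  set F := (finite_isRay b).toFinset with hF
  let M : Set (Fin n → ℝ) := {x | ∃ c : (Fin n → ℕ) → ℝ, (∀ a, 0 ≤ c a) ∧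
      ∀ j, x j = ∑ a ∈ F, c a * a j}
  have hM : ∀ (s : ℝ) (y), 0 ≤ s → y ∈ M → s • y ∈ M := by
    rintro s y hs ⟨c, hc, hy⟩
    refine ⟨fun a => s * c a, fun a => mul_nonneg hs (hc a), fun j => ?_⟩
    simp only [Pi.smul_apply, smul_eq_mul, hy j, Finset.mul_sum, mul_assoc]
  have hMconv : Convex ℝ M := by
    rintro y hy z hz s t hs ht -
    obtain ⟨c, hc, hy⟩ := hM s y hs hy
    obtain ⟨d, hd, hz⟩ := hM t z ht hz
    refine ⟨fun a => c a + d a, fun a => add_nonneg (hc a) (hd a), fun j => ?_⟩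
    simp only [Pi.add_apply, hy, hz, ← Finset.sum_add_distrib, add_mul]
  change x ∈ M
  rcases (Finset.sum_nonneg fun j _ => hx j : 0 ≤ ∑ j, x j).eq_or_lt' with h0 | h0
  · refine ⟨0, fun _ => le_rfl, fun j => ?_⟩
    simpa using (Finset.sum_eq_zero_iff_of_nonneg fun j _ => hx j).1 h0 j (Finset.mem_univ j)
  · set s := ∑ j, x j
    have hmem : s⁻¹ • x ∈ coneSlice b := by
      refine ⟨fun j => mul_nonneg (by positivity) (hx j), fun i => ?_, ?_⟩
      · have : ∑ j, (b i j : ℝ) * (s⁻¹ • x) j = s⁻¹ * ∑ j, (b i j : ℝ) * x j := by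
          rw [Finset.mul_sum]
          exact Finset.sum_congr rfl fun j _ => by simp only [Pi.smul_apply, smul_eq_mul]; ring
        rw [this]
        exact mul_nonneg (by positivity) (hbx i)
      · simp only [Pi.smul_apply, smul_eq_mul, ← Finset.mul_sum]
        exact inv_mul_cancel₀ h0.ne'
    let ν : (Fin n → ℕ) → (Fin n → ℝ) := fun a j => (∑ i, (a i : ℝ))⁻¹ * a j
    have hsub : (coneSlice b).extremePoints ℝ ⊆ ν '' F := by
      intro y hy
      obtain ⟨a, t, ha, -, hya⟩ := exists_isRay_of_mem_extremePoints hy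
      refine ⟨a, by simpa [hF] using ha, ?_⟩
      ext j
      have h1 := hy.1.2.2
      simp only [hya, ← Finset.mul_sum] at h1
      have : (∑ i, (a i : ℝ))⁻¹ = t := by
        rw [eq_comm]; exact eq_inv_of_mul_eq_one_left h1
      simp only [ν, this, hya]
    have h2 : s⁻¹ • x ∈ convexHull ℝ (ν '' F) := by
      -- Krein–Milman for the compact slice; the hull of finitely many points is closed, which
      -- absorbs the closure.
      rw [← closure_convexHull_extremePoints (isCompact_coneSlice b) (convex_coneSlice b)] at hmem
      exact closure_minimal (convexHull_mono hsub)
        ((F.finite_toSet.image ν).isClosed_convexHull ℝ) hmem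
    have h3 : s⁻¹ • x ∈ M := by
      refine convexHull_min ?_ hMconv h2
      rintro _ ⟨a, ha, rfl⟩
      refine ⟨Pi.single a (∑ i, (a i : ℝ))⁻¹, fun a' => ?_, fun j => ?_⟩
      · by_cases h : a' = a
        · subst h; simp only [Pi.single_eq_same]; positivity
        · simp [h]
      · rw [Finset.sum_eq_single a]
        · simp [ν]
        · intro a' _ h; simp [h]
        · intro h; exact absurd ha h
    have := hM s _ h0.le h3
    rwa [smul_inv_smul₀ h0.ne'] at this

/-- The lattice points of `{k | 0 ≤ k ∧ ∀ i, 0 ≤ ⟨b i, k⟩ + d i}`. -/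
def latticePoints (b : ι → Fin n → ℤ) (d : ι → ℤ) : Set (Fin n → ℕ) :=
  {k | ∀ i, 0 ≤ ∑ j, b i j * (k j : ℤ) + d i}

/-- Dickson's lemma applied to `k` together with its slacks: minimality in this enlarged order makes
`k - g` lie in the recession cone, not only in the orthant. -/
lemma exists_finite_le_of_latticePoints [Finite ι] (b : ι → Fin n → ℤ) (d : ι → ℤ) :
    ∃ G : Set (Fin n → ℕ), G.Finite ∧ G ⊆ latticePoints b d ∧ ∀ k ∈ latticePoints b d,
      ∃ g ∈ G, g ≤ k ∧ ∀ i, ∑ j, b i j * (g j : ℤ) ≤ ∑ j, b i j * (k j : ℤ) := by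
  let φ : (Fin n → ℕ) → (Fin n → ℕ) × (ι → ℕ) := fun k =>
    (k, fun i => (∑ j, b i j * (k j : ℤ) + d i).toNat)
  have hφ : Function.Injective φ := fun k k' h => (Prod.mk.inj h).1
  let T := φ '' latticePoints b d
  have hfin : {x | Minimal (· ∈ T) x}.Finite :=
    WellQuasiOrderedLE.finite_of_isAntichain (setOfPred_minimal_antichain _)
  refine ⟨φ ⁻¹' {x | Minimal (· ∈ T) x}, hfin.preimage hφ.injOn, ?_, ?_⟩
  · intro k hk
    obtain ⟨k', hk', h⟩ := hk.1
    rwa [← hφ h]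
  · intro k hk
    obtain ⟨m, hmx, hm⟩ := exists_minimal_le_of_wellFoundedLT (· ∈ T) (φ k) ⟨k, hk, rfl⟩
    obtain ⟨g, hg, rfl⟩ := hm.1
    refine ⟨g, hm, hmx.1, fun i => ?_⟩
    have h1 : (∑ j, b i j * (g j : ℤ) + d i).toNat ≤ (∑ j, b i j * (k j : ℤ) + d i).toNat :=
      hmx.2 i
    have h2 := hg i
    have h3 := hk i
    omega

/-- Gordan's argument: expand `k - g` in the rays and split off the integer parts of the
coefficients. The remainder `h` is integral, lies in the cone and is at most `∑ a ∈ F, a`, so only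
finitely many `g + h` occur. -/
lemma exists_genSet_eq_latticePoints [Finite ι] (b : ι → Fin n → ℤ) (d : ι → ℤ) :
    ∃ (E : Finset (Fin n → ℕ)) (R : ℕ) (a : Fin R → Fin n → ℕ), (∀ r, IsRay b (a r)) ∧
      latticePoints b d = genSet E a := by
  classical
  obtain ⟨G, hGfin, hG, hGle⟩ := exists_finite_le_of_latticePoints b d
  set F := (finite_isRay b).toFinset with hF
  let e := F.equivFin
  have hsumF : ∀ f : (Fin n → ℕ) → Fin n → ℕ, ∑ r, f (e.symm r) = ∑ a ∈ F, f a := fun f => by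
    rw [e.symm.sum_comp (fun a : F => f a), Finset.sum_coe_sort F f]
  have hEfin : {x ∈ latticePoints b d | ∃ g ∈ G, ∃ h ≤ ∑ a ∈ F, a, x = g + h}.Finite := by
    refine ((hGfin.prod (Set.finite_Iic (∑ a ∈ F, a))).image fun p => p.1 + p.2).subset ?_
    rintro x ⟨-, g, hg, h, hh, rfl⟩
    exact ⟨(g, h), ⟨hg, hh⟩, rfl⟩
  have hray : ∀ a ∈ F, IsRay b a := fun a ha => by simpa [hF] using ha
  have hcast : ∀ (i : ι) (k : Fin n → ℕ), ((∑ j, b i j * (k j : ℤ) : ℤ) : ℝ) =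
      ∑ j, (b i j : ℝ) * k j := fun i k => by push_cast; rfl
  refine ⟨hEfin.toFinset, F.card, fun r => e.symm r, fun r => hray _ (e.symm r).2, ?_⟩
  ext k
  constructor
  · intro hk
    obtain ⟨g, hg, hgk, hle⟩ := hGle k hk
    obtain ⟨c, hc, hkc⟩ := exists_nonneg_combination (b := b) (x := fun j => (k j : ℝ) - g j)
      (fun j => sub_nonneg.2 (by exact_mod_cast hgk j)) (fun i => by
        simp only [mul_sub, Finset.sum_sub_distrib, sub_nonneg]
        exact_mod_cast hle i)
    let m : Fin n → ℕ := ∑ a ∈ F, ⌊c a⌋₊ • a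
    have hm : ∀ j, (m j : ℝ) = ∑ a ∈ F, (⌊c a⌋₊ : ℝ) * a j := fun j => by
      simp [m, Finset.sum_apply]
    have hfr : ∀ j, (k j : ℝ) - g j - m j = ∑ a ∈ F, (c a - ⌊c a⌋₊) * a j := fun j => by
      rw [hkc, hm, ← Finset.sum_sub_distrib]
      exact Finset.sum_congr rfl fun a _ => by ring
    have hfr0 : ∀ a, 0 ≤ c a - ⌊c a⌋₊ := fun a => sub_nonneg.2 (Nat.floor_le (hc a))
    have hle' : g + m ≤ k := fun j => by
      have h1 : 0 ≤ (k j : ℝ) - g j - m j := by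
        rw [hfr]
        exact Finset.sum_nonneg fun a _ => mul_nonneg (hfr0 a) (Nat.cast_nonneg _)
      have h2 : ((g j + m j : ℕ) : ℝ) ≤ k j := by push_cast; linarith
      exact_mod_cast h2
    obtain ⟨h, rfl⟩ := exists_add_of_le hle'
    have hh : ∀ j, (h j : ℝ) = ∑ a ∈ F, (c a - ⌊c a⌋₊) * a j := fun j => by
      rw [← hfr, Pi.add_apply, Pi.add_apply]
      push_cast
      ring
    refine ⟨g + h, hEfin.mem_toFinset.2 ⟨fun i => ?_, g, hg, h, fun j => ?_, rfl⟩,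
      fun r => ⌊c (e.symm r)⌋₊, ?_⟩
    · have h1 := hG hg i
      have h2 : (0 : ℝ) ≤ ((∑ j, b i j * (h j : ℤ) : ℤ) : ℝ) := by
        rw [hcast]
        simp only [hh, Finset.mul_sum]
        rw [Finset.sum_comm]
        refine Finset.sum_nonneg fun a ha => ?_
        have h3 : ∑ j, (b i j : ℝ) * ((c a - ⌊c a⌋₊) * a j)
            = (c a - ⌊c a⌋₊) * ((∑ j, b i j * (a j : ℤ) : ℤ) : ℝ) := by
          rw [hcast, Finset.mul_sum]
          exact Finset.sum_congr rfl fun j _ => by ring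
        rw [h3]
        exact mul_nonneg (hfr0 a) (by exact_mod_cast (hray a ha).mem i)
      have h3 : 0 ≤ ∑ j, b i j * (h j : ℤ) := by exact_mod_cast h2
      simp only [Pi.add_apply, Nat.cast_add, mul_add, Finset.sum_add_distrib]
      linarith
    · have h1 : (h j : ℝ) ≤ ((∑ a ∈ F, a : Fin n → ℕ) j : ℕ) := by
        rw [hh, Finset.sum_apply]
        push_cast
        refine Finset.sum_le_sum fun a _ => mul_le_of_le_one_left (Nat.cast_nonneg _) ?_
        have := Nat.lt_floor_add_one (c a)
        linarith
      exact_mod_cast h1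
    · rw [hsumF fun a => ⌊c a⌋₊ • a]
      change g + m + h = g + h + m
      abel
  · rintro ⟨x, hx, c, rfl⟩ i
    have h1 := (hEfin.mem_toFinset.1 hx).1 i
    have h2 : ∑ j, b i j * (((∑ r, c r • (e.symm r : Fin n → ℕ)) j : ℕ) : ℤ)
        = ∑ r, (c r : ℤ) * ∑ j, b i j * ((e.symm r : Fin n → ℕ) j : ℤ) := by
      simp only [Finset.sum_apply, Pi.smul_apply, smul_eq_mul, Nat.cast_sum, Nat.cast_mul,
        Finset.mul_sum]
      rw [Finset.sum_comm]
      exact Finset.sum_congr rfl fun r _ => Finset.sum_congr rfl fun j _ => by ring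
    have h3 : 0 ≤ ∑ r, (c r : ℤ) * ∑ j, b i j * ((e.symm r : Fin n → ℕ) j : ℤ) :=
      Finset.sum_nonneg fun r _ => mul_nonneg (Nat.cast_nonneg _) ((hray _ (e.symm r).2).mem i)
    rw [← h2] at h3
    simp only [Pi.add_apply, Nat.cast_add, mul_add, Finset.sum_add_distrib]
    linarith

/-- The generating series of the lattice points of a rational polyhedron in the positive orthant
is rational, with denominators coming from the extremal rays of its recession cone. -/
theorem exists_polynomial_latticePoints [Finite ι] (b : ι → Fin n → ℤ) (d : ι → ℤ) :
    ∃ (R : ℕ) (a : Fin R → Fin n → ℕ) (p : MvPolynomial (Fin n) ℂ), (∀ r, IsRay b (a r)) ∧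
      ∀ w : Fin n → ℂ, (∀ j, ‖w j‖ < 1) →
        (∑' k : latticePoints b d, wt w k) * ∏ r, (1 - wt w (a r)) = MvPolynomial.eval w p := by
  obtain ⟨E, R, a, ha, h⟩ := exists_genSet_eq_latticePoints b d
  obtain ⟨p, hp⟩ := exists_polynomial_genSet E a fun r => ne_zero_of_gcd_eq_one (ha r).gcd_eq_one
  exact ⟨R, a, p, ha, by rw [h]; exact hp⟩

end Cone

/-! ### Rays of the normal cones as facets of the Newton polyhedron. -/

section NewtonPolyhedron
variable {n l : ℕ}

lemma add_mem_newtonPolyhedron {S : Set (Fin n → ℕ)} {m : Fin n → ℕ} (hm : m ∈ S)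
    {y : Fin n → ℝ} (hy : ∀ j, 0 ≤ y j) : (fun j => (m j : ℝ)) + y ∈ newtonPolyhedron S :=
  subset_convexHull _ _ (Set.mem_biUnion hm ⟨y, hy, rfl⟩)

lemma mem_newtonPolyhedron {S : Set (Fin n → ℕ)} {m : Fin n → ℕ} (hm : m ∈ S) :
    (fun j => (m j : ℝ)) ∈ newtonPolyhedron S := by
  simpa using add_mem_newtonPolyhedron hm (y := 0) fun _ => le_rfl

lemma le_dotProduct_of_mem_newtonPolyhedron {S : Set (Fin n → ℕ)} {a : Fin n → ℝ} {c : ℝ}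
    (ha : ∀ j, 0 ≤ a j) (h : ∀ m ∈ S, c ≤ a ⬝ᵥ fun j => (m j : ℝ)) {x : Fin n → ℝ}
    (hx : x ∈ newtonPolyhedron S) : c ≤ a ⬝ᵥ x := by
  have hconv : Convex ℝ {x : Fin n → ℝ | c ≤ a ⬝ᵥ x} := by
    intro x hx y hy s t hs ht hst
    simp only [Set.mem_ofPred_eq, dotProduct_add, dotProduct_smul, smul_eq_mul] at *
    calc c = s * c + t * c := by rw [← add_mul, hst, one_mul]
      _ ≤ _ := by gcongr
  refine convexHull_min ?_ hconv hx
  refine Set.iUnion₂_subset fun m hm => ?_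
  rintro _ ⟨y, hy, rfl⟩
  simp only [Set.mem_ofPred_eq, dotProduct_add]
  have : 0 ≤ a ⬝ᵥ y := Finset.sum_nonneg fun j _ => mul_nonneg (ha j) (hy j)
  linarith [h m hm]

/-- A subspace whose only functionals vanishing on it are the multiples of a nonzero one has
codimension one. -/
lemma finrank_add_one_eq_of_dotProduct {W : Submodule ℝ (Fin n → ℝ)} {a : Fin n → ℝ} (ha : a ≠ 0)
    (h1 : ∀ x ∈ W, a ⬝ᵥ x = 0)
    (h2 : ∀ u : Fin n → ℝ, (∀ x ∈ W, u ⬝ᵥ x = 0) → ∃ t : ℝ, u = t • a) :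
    Module.finrank ℝ W + 1 = n := by
  let e := dotProductEquiv ℝ (Fin n)
  have hW : W.dualAnnihilator = Submodule.span ℝ {e a} := by
    ext f
    obtain ⟨u, rfl⟩ := e.surjective f
    rw [Submodule.mem_dualAnnihilator, Submodule.mem_span_singleton]
    constructor
    · intro h
      obtain ⟨t, rfl⟩ := h2 u h
      exact ⟨t, by simp⟩
    · rintro ⟨t, ht⟩ x hx
      rw [← ht]
      simp [e, h1 x hx]
  have h3 := Subspace.finrank_add_finrank_dualAnnihilator_eq W
  rw [hW, finrank_span_singleton (by simpa using ha)] at h3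
  simpa using h3

variable {N : Fin l → Fin n → ℕ} {i : Fin l} {a : Fin n → ℕ}

lemma le_of_isRay (ha : IsRay (fun i' j => (N i' j : ℤ) - N i j) a) (i' : Fin l) :
    ∑ j, (a j : ℝ) * N i j ≤ ∑ j, (a j : ℝ) * N i' j := by
  have h := ha.mem i'
  simp only [sub_mul, Finset.sum_sub_distrib, sub_nonneg] at h
  simp only [mul_comm (a _ : ℝ)]
  exact_mod_cast h

lemma supportMin_of_isRay (ha : IsRay (fun i' j => (N i' j : ℤ) - N i j) a) :
    supportMin (newtonPolyhedron (Set.range N)) (fun j => (a j : ℝ)) =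
      ∑ j, (a j : ℝ) * N i j := by
  refine IsLeast.csInf_eq ⟨⟨_, mem_newtonPolyhedron (Set.mem_range_self i), rfl⟩, ?_⟩
  rintro _ ⟨x, hx, rfl⟩
  refine le_dotProduct_of_mem_newtonPolyhedron (fun j => Nat.cast_nonneg _) ?_ hx
  rintro _ ⟨i', rfl⟩
  exact le_of_isRay ha i'

/-- The face directions include the unit vectors at the zeros of `a` and the differences `N i' - N
i` for active `i'`. A functional killing these is a multiple of `a` by `IsRay.ker`, so the face has
codimension one. -/
theorem isFacet_of_isRay (ha : IsRay (fun i' j => (N i' j : ℤ) - N i j) a) :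
    IsFacet (newtonPolyhedron (Set.range N)) {x ∈ newtonPolyhedron (Set.range N) |
      (fun j => (a j : ℝ)) ⬝ᵥ x =
        supportMin (newtonPolyhedron (Set.range N)) (fun j => (a j : ℝ))} := by
  classical
  set Γ := newtonPolyhedron (Set.range N)
  set A : Fin n → ℝ := fun j => (a j : ℝ) with hA
  have hm := supportMin_of_isRay ha
  set m := supportMin Γ A
  set γ := {x ∈ Γ | A ⬝ᵥ x = m}
  have hle : ∀ x ∈ Γ, m ≤ A ⬝ᵥ x := by
    intro x hx
    refine le_dotProduct_of_mem_newtonPolyhedron (fun j => Nat.cast_nonneg _) ?_ hx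
    rintro _ ⟨i', rfl⟩
    rw [hm]
    exact le_of_isRay ha i'
  have hNi : (fun j => (N i j : ℝ)) ∈ γ := ⟨mem_newtonPolyhedron (Set.mem_range_self i), hm.symm⟩
  refine ⟨fun _ => ?_, ⟨_, hNi⟩, ?_⟩
  -- Exposed faces are sets of maximizers, hence the sign.
  · refine ⟨-(LinearMap.toContinuousLinearMap (dotProductEquiv ℝ (Fin n) A)), ?_⟩
    ext x
    constructor
    · rintro ⟨hx, hxm⟩
      refine ⟨hx, fun y hy => ?_⟩
      simpa [hxm] using hle y hy
    · rintro ⟨hx, h⟩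
      refine ⟨hx, le_antisymm ?_ (hle x hx)⟩
      have := h _ hNi.1
      rw [← hNi.2]
      simpa using this
  · have ha0 : A ≠ 0 := fun h => ne_zero_of_gcd_eq_one ha.gcd_eq_one (by
      ext j
      simpa [hA] using congrFun h j)
    have hmem : ∀ y ∈ γ, y - (fun j => (N i j : ℝ)) ∈ vectorSpan ℝ γ := fun y hy =>
      vsub_mem_vectorSpan ℝ hy hNi
    refine finrank_add_one_eq_of_dotProduct ha0 ?_ ?_
    · intro x hx
      have : vectorSpan ℝ γ ≤ LinearMap.ker (dotProductEquiv ℝ (Fin n) A) := by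
        rw [vectorSpan_def, Submodule.span_le]
        rintro _ ⟨y, hy, z, hz, rfl⟩
        simp [dotProduct_sub, hy.2, hz.2]
      simpa using this hx
    · intro u hu
      have k1 : ∀ j, a j = 0 → u j = 0 := by
        intro j hj
        have h1 : (fun j => (N i j : ℝ)) + Pi.single j 1 ∈ γ := by
          refine ⟨add_mem_newtonPolyhedron (Set.mem_range_self i) fun j' => ?_, ?_⟩
          · by_cases h : j' = j
            · subst h; simp
            · simp [h]
          · rw [dotProduct_add, hNi.2]
            simp [hA, hj]
        simpa using hu _ (hmem _ h1)
      have k2 : ∀ i', ∑ j, ((N i' j : ℤ) - N i j) * (a j : ℤ) = 0 →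
          ∑ j, (((N i' j : ℤ) - N i j : ℤ) : ℝ) * u j = 0 := by
        intro i' hi'
        have h1 : (fun j => (N i' j : ℝ)) ∈ γ := by
          refine ⟨mem_newtonPolyhedron (Set.mem_range_self i'), ?_⟩
          rw [hm]
          have : ∑ j, (a j : ℝ) * N i' j - ∑ j, (a j : ℝ) * N i j = 0 := by
            rw [← Finset.sum_sub_distrib, ← Int.cast_zero, ← hi']
            push_cast
            exact Finset.sum_congr rfl fun j _ => by ring
          exact sub_eq_zero.1 this
        rw [← hu _ (hmem _ h1)]
        push_cast
        exact Finset.sum_congr rfl fun j _ => by simp [mul_comm]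
      obtain ⟨t, ht⟩ := ha.ker u k1 k2
      exact ⟨t, funext ht⟩

lemma isPrimitiveNormal_of_isRay (ha : IsRay (fun i' j => (N i' j : ℤ) - N i j) a) {m : ℝ}
    (Γ : Set (Fin n → ℝ)) :
    IsPrimitiveNormal {x ∈ Γ | (fun j => (a j : ℝ)) ⬝ᵥ x = m} a :=
  ⟨ha.gcd_eq_one, fun x hx y hy => by rw [dotProduct_sub, hx.2, hy.2, sub_self]⟩

end NewtonPolyhedron

/-! ### The normalized valuation and powers of the maximal ideal. -/

section Valuation

variable {K : Type*} [Field K] [ValuativeRel K] [TopologicalSpace K]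
  [IsNonarchimedeanLocalField K]

lemma ord_mul {x y : K} (hx : x ≠ 0) (hy : y ≠ 0) : ord (x * y) = ord x + ord y := by
  rw [ord, map_mul, map_mul, WithZero.log_mul (by simpa using hx) (by simpa using hy)]
  simp only [ord]
  ring

lemma ord_pow (x : K) (m : ℕ) : ord (x ^ m) = m * ord x := by
  simp [ord, WithZero.log_pow]

lemma ord_prod {ι : Type*} (s : Finset ι) {f : ι → K} (hf : ∀ i ∈ s, f i ≠ 0) :
    ord (∏ i ∈ s, f i) = ∑ i ∈ s, ord (f i) := by
  classical
  induction s using Finset.induction_on with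
  | empty => simp [ord]
  | insert a s ha ih =>
    rw [Finset.prod_insert ha, Finset.sum_insert ha, ord_mul (hf a (Finset.mem_insert_self a s))
      (Finset.prod_ne_zero_iff.2 fun i hi => hf i (Finset.mem_insert_of_mem hi)),
      ih fun i hi => hf i (Finset.mem_insert_of_mem hi)]

lemma ord_le_ord {x y : K} (hx : x ≠ 0) (hy : y ≠ 0) :
    ord x ≤ ord y ↔ valuation K y ≤ valuation K x := by
  rw [ord, ord, neg_le_neg_iff, WithZero.log_le_log (by simpa using hy) (by simpa using hx),
    map_le_map_iff]

lemma ord_nonneg_iff {x : K} (hx : x ≠ 0) : 0 ≤ ord x ↔ x ∈ 𝒪[K] := by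
  have h1 : ord (1 : K) = 0 := by simp [ord]
  rw [← h1, ord_le_ord one_ne_zero hx, map_one, Valuation.mem_integer_iff]

variable (K) in
lemma exists_ord_eq_one : ∃ π : K, π ≠ 0 ∧ ord π = 1 := by
  obtain ⟨π, hπ⟩ := ValuativeRel.valuation_surjective
    ((IsNonarchimedeanLocalField.valueGroupWithZeroIsoInt K).symm (WithZero.exp (-1)))
  have h : IsNonarchimedeanLocalField.valueGroupWithZeroIsoInt K (valuation K π)
      = WithZero.exp (-1) := by rw [hπ, OrderMonoidIso.apply_symm_apply]
  refine ⟨π, ?_, by rw [ord, h, WithZero.log_exp, neg_neg]⟩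
  rintro rfl
  rw [map_zero, map_zero] at h
  exact WithZero.exp_ne_zero h.symm

variable (K) in
/-- The fractional ideal `𝒫_K ^ m` as an additive subgroup of `K`. -/
def ball (m : ℤ) : AddSubgroup K where
  carrier := {z | z = 0 ∨ m ≤ ord z}
  zero_mem' := Or.inl rfl
  add_mem' := by
    intro x y hx hy
    by_cases hx0 : x = 0
    · simpa [hx0] using hy
    by_cases hy0 : y = 0
    · simpa [hy0] using hx
    by_cases hxy : x + y = 0
    · exact Or.inl hxy
    right
    have hx := hx.resolve_left hx0
    have hy := hy.resolve_left hy0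
    rcases le_max_iff.1 ((valuation K).map_add x y) with h | h
    · exact hx.trans ((ord_le_ord hx0 hxy).2 h)
    · exact hy.trans ((ord_le_ord hy0 hxy).2 h)
  neg_mem' := by
    intro x hx
    simpa [ord, Valuation.map_neg] using hx

lemma mem_ball {m : ℤ} {z : K} : z ∈ ball K m ↔ z = 0 ∨ m ≤ ord z := Iff.rfl

lemma mem_ball_zero {z : K} : z ∈ ball K 0 ↔ z ∈ 𝒪[K] := by
  by_cases hz : z = 0
  · simp [hz, zero_mem]
  · simp [mem_ball, hz, ord_nonneg_iff hz]

lemma ball_anti {m m' : ℤ} (h : m ≤ m') : ball K m' ≤ ball K m :=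
  fun _ hz => hz.imp_right h.trans

lemma mul_mem_ball_iff {m d : ℤ} {z t : K} (ht : t ≠ 0) (hd : ord t = d) :
    t * z ∈ ball K (d + m) ↔ z ∈ ball K m := by
  by_cases hz : z = 0
  · simp [hz]
  · simp [mem_ball, hz, ht, ord_mul ht hz, hd]

lemma isOpen_ball (m : ℤ) : IsOpen (ball K m : Set K) := by
  obtain ⟨π, hπ, hπ1⟩ := exists_ord_eq_one K
  have hm : ord (π ^ m) = m := by
    rw [ord, map_zpow₀, map_zpow₀, WithZero.log_zpow]
    have : WithZero.log (IsNonarchimedeanLocalField.valueGroupWithZeroIsoInt K (valuation K π))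
      = -1 := by rw [ord] at hπ1; omega
    simp [this]
  have hm0 : π ^ m ≠ 0 := zpow_ne_zero _ hπ
  refine AddSubgroup.isOpen_of_mem_nhds (g := 0) _ ?_
  refine (IsValuativeTopology.hasBasis_nhds_zero' K).mem_iff.2
    ⟨valuation K (π ^ m), (valuation K).ne_zero_iff.2 hm0, fun z hz => ?_⟩
  by_cases hz0 : z = 0
  · exact Or.inl hz0
  · exact Or.inr (hm ▸ (ord_le_ord hm0 hz0).2 (le_of_lt hz))

lemma mem_maximalIdeal_iff (y : 𝒪[K]) : y ∈ 𝓂[K] ↔ (y : K) ∈ ball K 1 := by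
  rw [IsLocalRing.mem_maximalIdeal, mem_nonunits_iff,
    Valuation.Integer.not_isUnit_iff_valuation_lt_one]
  by_cases hy : (y : K) = 0
  · simp [hy]
  · have h1 : ord (1 : K) = 0 := by simp [ord]
    rw [← not_le, ← map_one (valuation K), ← ord_le_ord hy one_ne_zero, h1, mem_ball]
    simp only [hy, false_or]
    omega

/-- A uniformizer generates the maximal ideal, and divisibility in the valuation ring is comparison
of valuations. -/
lemma mem_maximalIdeal_pow_iff (e : ℕ) (y : 𝒪[K]) : y ∈ 𝓂[K] ^ e ↔ (y : K) ∈ ball K e := by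
  obtain ⟨π, hπ, hπ1⟩ := exists_ord_eq_one K
  have hdvd : ∀ (m : ℕ) (t y : 𝒪[K]), (t : K) ≠ 0 → ord (t : K) = m →
      (t ∣ y ↔ (y : K) ∈ ball K m) := by
    intro m t y ht0 ht
    rw [(Valuation.integer.integers (valuation K)).dvd_iff_le]
    change valuation K (y : K) ≤ valuation K (t : K) ↔ _
    by_cases hy : (y : K) = 0
    · simp [hy]
    · rw [mem_ball, ← ht, ord_le_ord ht0 hy]
      simp [hy]
  let ϖ : 𝒪[K] := ⟨π, (ord_nonneg_iff hπ).1 (by omega)⟩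
  have hspan : 𝓂[K] = Ideal.span {ϖ} := by
    ext y
    rw [mem_maximalIdeal_iff, Ideal.mem_span_singleton, hdvd 1 ϖ y hπ (by simpa using hπ1)]
    simp
  rw [hspan, Ideal.span_singleton_pow, Ideal.mem_span_singleton]
  refine hdvd e _ y (pow_ne_zero e hπ) ?_
  rw [SubmonoidClass.coe_pow, ord_pow, hπ1, mul_one]

lemma one_lt_resCard : 1 < resCard K := Finite.one_lt_card

lemma absK_of_ne_zero {z : K} (hz : z ≠ 0) : absK z = (resCard K : ℝ) ^ (-ord z) := by
  simp [absK, hz]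

end Valuation

/-! ### Haar measure of shells and integration over the polydisc. -/

section Measure

variable {K : Type*} [Field K] [ValuativeRel K] [TopologicalSpace K]
  [IsNonarchimedeanLocalField K] {n : ℕ}

variable (K) in
/-- The points `x` with `x j ∈ 𝒫_K ^ k j` for all `j`, and `x j ∉ 𝒫_K ^ (k j + 1)` for
`j ∈ J`. -/
def shell (J : Finset (Fin n)) (k : Fin n → ℕ) : Set (Fin n → K) :=
  {x | ∀ j, x j ∈ ball K (k j) ∧ (j ∈ J → x j ∉ ball K (k j + 1))}

lemma mem_shell_univ {k : Fin n → ℕ} {x : Fin n → K} :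
    x ∈ shell K Finset.univ k ↔ ∀ j, x j ≠ 0 ∧ ord (x j) = k j := by
  refine forall_congr' fun j => ?_
  simp only [Finset.mem_univ, forall_const, mem_ball, not_or, not_le]
  constructor
  · rintro ⟨h1, h2, h3⟩
    exact ⟨h2, by have := h1.resolve_left h2; omega⟩
  · rintro ⟨h1, h2⟩
    exact ⟨Or.inr h2.ge, h1, by omega⟩

lemma polydisc_eq_shell (e : ℕ) : polydisc K n e = shell K ∅ fun _ => e := by
  ext x
  refine forall_congr' fun j => ?_
  simp only [Finset.notMem_empty, false_imp_iff, and_true]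
  constructor
  · rintro ⟨y, hy, hyx⟩
    rwa [mem_maximalIdeal_pow_iff, hyx] at hy
  · intro h
    refine ⟨⟨x j, mem_ball_zero.1 (ball_anti (Int.natCast_nonneg e) h)⟩, ?_, rfl⟩
    rwa [mem_maximalIdeal_pow_iff]

variable [MeasurableSpace K] [BorelSpace K]

lemma measurableSet_shell (J : Finset (Fin n)) (k : Fin n → ℕ) :
    MeasurableSet (shell K J k) := by
  have hb : ∀ m : ℤ, MeasurableSet (ball K m : Set K) := fun m => (isOpen_ball m).measurableSet
  have : shell K J k = ⋂ j, (fun x : Fin n → K => x j) ⁻¹'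
      {z | z ∈ ball K (k j) ∧ (j ∈ J → z ∉ ball K (k j + 1))} := by
    ext x; simp [shell]
  rw [this]
  refine MeasurableSet.iInter fun j => measurable_pi_apply j ?_
  by_cases hj : j ∈ J
  · simp only [hj, forall_const]
    exact (hb _).inter (hb _).compl
  · simp only [hj, false_imp_iff, and_true]
    exact hb _

variable (μ : Measure (Fin n → K)) [μ.IsAddHaarMeasure]

/-- In the `j`-th coordinate, `𝒫_K ^ k j` is the disjoint union of `q` translates of `𝒫_K ^ (k j +
1)`, one for each residue class. -/
lemma measure_shell_empty_step (k : Fin n → ℕ) (j : Fin n) :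
    μ (shell K ∅ k) = resCard K * μ (shell K ∅ (k + Pi.single j 1)) := by
  classical
  obtain ⟨π, hπ, hπ1⟩ := exists_ord_eq_one K
  have hπk : ord (π ^ k j) = k j := by rw [ord_pow, hπ1, mul_one]
  have hπ0 : π ^ k j ≠ 0 := pow_ne_zero _ hπ
  let ρ : 𝓀[K] → 𝒪[K] := Function.surjInv (IsLocalRing.residue_surjective (R := 𝒪[K]))
  have hρ : ∀ r, IsLocalRing.residue 𝒪[K] (ρ r) = r := Function.surjInv_eq _
  let t : 𝓀[K] → Fin n → K := fun r => Pi.single j (π ^ k j * ρ r)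
  have hres : ∀ (y : 𝒪[K]) (r : 𝓀[K]),
      (y : K) - ρ r ∈ ball K 1 ↔ IsLocalRing.residue 𝒪[K] y = r := by
    intro y r
    rw [← AddSubgroupClass.coe_sub, ← mem_maximalIdeal_iff, ← IsLocalRing.residue_eq_zero_iff, map_sub, hρ,
      sub_eq_zero]
  have hmem : ∀ (r : 𝓀[K]) (x : Fin n → K),
      -t r + x ∈ shell K ∅ (k + Pi.single j 1) ↔
        (∀ i ≠ j, x i ∈ ball K (k i)) ∧ x j - π ^ k j * ρ r ∈ ball K (k j + 1) := by
    intro r x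
    simp only [shell, Finset.notMem_empty, false_imp_iff, and_true, Set.mem_ofPred_eq]
    constructor
    · intro h
      refine ⟨fun i hi => by simpa [t, hi] using h i, ?_⟩
      have := h j
      simpa [t, neg_add_eq_sub] using this
    · rintro ⟨h1, h2⟩ i
      by_cases hi : i = j
      · subst hi; simpa [t, neg_add_eq_sub] using h2
      · simpa [t, hi] using h1 i hi
  have hscale : ∀ (y z : K), π ^ k j * y - π ^ k j * z ∈ ball K (k j + 1) ↔ y - z ∈ ball K 1 :=
    fun y z => by rw [← mul_sub, mul_mem_ball_iff hπ0 hπk]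
  have hunion : shell K ∅ k =
      ⋃ r : 𝓀[K], (fun x => -t r + x) ⁻¹' shell K ∅ (k + Pi.single j 1) := by
    ext x
    simp only [Set.mem_iUnion, Set.mem_preimage, hmem]
    constructor
    · intro hx
      have hxj := (hx j).1
      obtain ⟨y, hy⟩ : ∃ y, x j = π ^ k j * y := ⟨x j / π ^ k j, by field_simp⟩
      have hy0 : y ∈ 𝒪[K] := by
        rw [hy, ← add_zero (k j : ℤ), mul_mem_ball_iff hπ0 hπk] at hxj
        exact mem_ball_zero.1 hxj
      refine ⟨IsLocalRing.residue 𝒪[K] ⟨y, hy0⟩, fun i _ => (hx i).1, ?_⟩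
      rw [hy, hscale]
      exact (hres ⟨y, hy0⟩ _).2 rfl
    · rintro ⟨r, h1, h2⟩ i
      refine ⟨?_, by simp⟩
      by_cases hi : i = j
      · subst hi
        have h3 : π ^ k i * ρ r ∈ ball K (k i) := by
          have := (mul_mem_ball_iff (m := 0) hπ0 hπk).2 (mem_ball_zero.2 (ρ r).2)
          simpa using this
        simpa using add_mem (ball_anti (by omega) h2) h3
      · exact h1 i hi
  have hdisj : Pairwise (Function.onFun Disjoint
      fun r : 𝓀[K] => (fun x => -t r + x) ⁻¹' shell K ∅ (k + Pi.single j 1)) := by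
    intro r r' hne
    refine Set.disjoint_left.2 fun x hx hx' => hne ?_
    have h1 := ((hmem r x).1 hx).2
    have h2 := ((hmem r' x).1 hx').2
    have h3 := sub_mem h2 h1
    rw [sub_sub_sub_cancel_left, hscale, hres, hρ] at h3
    exact h3
  have := Fintype.ofFinite 𝓀[K]
  rw [hunion, measure_iUnion hdisj fun r =>
    (measurable_const_add _) (measurableSet_shell _ _), tsum_fintype]
  simp only [measure_preimage_add]
  simp [resCard, Nat.card_eq_fintype_card]

omit [MeasurableSpace K] [BorelSpace K] in
lemma shell_zero : shell K ∅ (0 : Fin n → ℕ) = {x | ∀ j, x j ∈ 𝒪[K]} := by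
  ext x
  simp [shell, mem_ball_zero]

variable (hμ : μ {x | ∀ j, x j ∈ 𝒪[K]} = 1)
include hμ

omit [BorelSpace K] [μ.IsAddHaarMeasure] in
lemma measure_shell_lt_top (J : Finset (Fin n)) (k : Fin n → ℕ) : μ (shell K J k) < ⊤ := by
  refine (measure_mono fun x hx j => ?_).trans_lt (hμ.trans_lt ENNReal.one_lt_top)
  exact mem_ball_zero.1 (ball_anti (Int.natCast_nonneg _) (hx j).1)

lemma measureReal_shell_empty (k : Fin n → ℕ) :
    μ.real (shell K ∅ k) = ((resCard K : ℝ)⁻¹) ^ ∑ j, k j := by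
  classical
  induction hs : ∑ j, k j generalizing k with
  | zero =>
    have : k = 0 := funext fun j => by simpa using (Finset.sum_eq_zero_iff.1 hs) j
    rw [this, shell_zero, measureReal_def, hμ]
    simp
  | succ s ih =>
    obtain ⟨j, hj⟩ : ∃ j, k j ≠ 0 := by
      by_contra! h
      simp [h] at hs
    obtain ⟨k', rfl⟩ : ∃ k', k = k' + Pi.single j 1 :=
      ⟨k - Pi.single j 1, by
        rw [← add_single_sub_single hj, add_tsub_cancel_right]⟩
    have h1 := ih k' (by simpa [Finset.sum_add_distrib] using hs)
    have hq : (resCard K : ℝ) ≠ 0 := by have := one_lt_resCard (K := K); positivity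
    rw [measureReal_def, measure_shell_empty_step μ k' j, ENNReal.toReal_mul,
      ENNReal.toReal_natCast, ← measureReal_def] at h1
    rw [pow_succ, ← h1]
    field_simp

/-- Inserting `j` into `J` removes the shell with `k j` raised by one, which carries a fraction
`q⁻¹` of the measure. -/
lemma measureReal_shell (J : Finset (Fin n)) (k : Fin n → ℕ) :
    μ.real (shell K J k) =
      (1 - (resCard K : ℝ)⁻¹) ^ J.card * ((resCard K : ℝ)⁻¹) ^ ∑ j, k j := by
  classical
  induction J using Finset.induction_on generalizing k with
  | empty => simp [measureReal_shell_empty μ hμ]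
  | insert j J hj ih =>
    have hdec : shell K J k = shell K (insert j J) k ∪ shell K J (k + Pi.single j 1) := by
      ext x
      constructor
      · intro hx
        by_cases hxj : x j ∈ ball K (k j + 1)
        · right
          intro i
          by_cases hi : i = j
          · subst hi; simpa [hj] using hxj
          · simpa [hi] using hx i
        · left
          intro i
          refine ⟨(hx i).1, fun hi => ?_⟩
          rcases Finset.mem_insert.1 hi with rfl | hi
          · exact hxj
          · exact (hx i).2 hi
      · rintro (hx | hx) i
        · exact ⟨(hx i).1, fun hi => (hx i).2 (Finset.mem_insert_of_mem hi)⟩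
        · by_cases hi : i = j
          · subst hi
            refine ⟨ball_anti ?_ (hx i).1, fun h => absurd h hj⟩
            simp
          · simpa [hi] using hx i
    have hdisj : Disjoint (shell K (insert j J) k) (shell K J (k + Pi.single j 1)) := by
      refine Set.disjoint_left.2 fun x hx hx' => (hx j).2 (Finset.mem_insert_self _ _) ?_
      simpa using (hx' j).1
    have h1 := ih k
    rw [hdec, measureReal_union hdisj (measurableSet_shell _ _)
      (measure_shell_lt_top μ hμ _ _).ne (measure_shell_lt_top μ hμ _ _).ne,
      ih (k + Pi.single j 1)] at h1
    have hsum : ∑ i, (k + Pi.single j 1 : Fin n → ℕ) i = ∑ i, k i + 1 := by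
      simp [Finset.sum_add_distrib]
    rw [hsum] at h1
    rw [Finset.card_insert_of_notMem hj, eq_sub_of_add_eq h1]
    ring

/-- For every `m` the set lies in the polydisc whose `j`-th factor is `𝒫_K ^ m`, of measure `q ^
(-m)`. -/
lemma measure_coordinate_zero (j : Fin n) : μ {x | (∀ i, x i ∈ 𝒪[K]) ∧ x j = 0} = 0 := by
  classical
  have hq : (resCard K : ℝ)⁻¹ < 1 := inv_lt_one_of_one_lt₀ (by exact_mod_cast one_lt_resCard)
  have hlim := tendsto_pow_atTop_nhds_zero_of_lt_one (by positivity) hq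
  have hle : ∀ m : ℕ, μ.real {x | (∀ i, x i ∈ 𝒪[K]) ∧ x j = 0} ≤ ((resCard K : ℝ)⁻¹) ^ m := by
    intro m
    have h1 := measureReal_shell_empty μ hμ (Pi.single j m)
    rw [Finset.sum_pi_single'] at h1
    simp only [Finset.mem_univ, if_true] at h1
    rw [← h1]
    refine measureReal_mono (fun x hx i => ⟨?_, by simp⟩) (measure_shell_lt_top μ hμ _ _).ne
    by_cases hi : i = j
    · subst hi; exact Or.inl hx.2
    · simpa [hi] using mem_ball_zero.2 (hx.1 i)
  have h0 : μ.real {x | (∀ i, x i ∈ 𝒪[K]) ∧ x j = 0} = 0 :=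
    le_antisymm (ge_of_tendsto' hlim hle) measureReal_nonneg
  refine (measureReal_eq_zero_iff ?_).1 h0
  exact ((measure_mono fun x hx => hx.1).trans_lt (hμ.trans_lt ENNReal.one_lt_top)).ne

lemma iUnion_shell_ae_eq_polydisc (e : ℕ) :
    (⋃ k : Fin n → ℕ, shell K Finset.univ (k + fun _ => e)) =ᵐ[μ] polydisc K n e := by
  have hsub : (⋃ k : Fin n → ℕ, shell K Finset.univ (k + fun _ => e)) ⊆ polydisc K n e := by
    rw [polydisc_eq_shell]
    refine Set.iUnion_subset fun k x hx j => ⟨ball_anti ?_ (hx j).1, by simp⟩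
    simp
  refine Filter.EventuallyLE.antisymm (Filter.Eventually.of_forall hsub) ?_
  rw [ae_le_set]
  refine measure_mono_null ?_ (measure_iUnion_null fun j => measure_coordinate_zero μ hμ j)
  rintro x ⟨hx, hxn⟩
  rw [polydisc_eq_shell] at hx
  by_contra h
  simp only [Set.mem_iUnion, not_exists, Set.mem_ofPred_eq, not_and] at h
  have h0 : ∀ j, x j ≠ 0 := fun j => h j fun i =>
    mem_ball_zero.1 (ball_anti (Int.natCast_nonneg e) (hx i).1)
  refine hxn (Set.mem_iUnion.2 ⟨fun j => (ord (x j)).toNat - e, mem_shell_univ.2 fun j =>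
    ⟨h0 j, ?_⟩⟩)
  have h1 : (e : ℤ) ≤ ord (x j) := (hx j).1.resolve_left (h0 j)
  simp only [Pi.add_apply]
  omega

/-- Integration over the polydisc of a function which is constant on the sets where all
`ord (x j)` are prescribed. -/
theorem integral_polydisc {e : ℕ} {F : (Fin n → K) → ℂ} {val : (Fin n → ℕ) → ℂ}
    (hF : ∀ k, ∀ x ∈ shell K Finset.univ (k + fun _ => e), F x = val k)
    (hs : Summable fun k : Fin n → ℕ => ((resCard K : ℝ)⁻¹) ^ (∑ j, k j) * ‖val k‖) :
    IntegrableOn F (polydisc K n e) μ ∧ ∫ x in polydisc K n e, F x ∂μ =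
      ∑' k : Fin n → ℕ, ((1 - (resCard K : ℂ)⁻¹) ^ n *
        ((resCard K : ℂ)⁻¹) ^ (n * e)) * (((resCard K : ℂ)⁻¹) ^ (∑ j, k j) * val k) := by
  have hae := iUnion_shell_ae_eq_polydisc μ hμ e
  have hmeas : ∀ k : Fin n → ℕ, MeasurableSet (shell K Finset.univ (k + fun _ => e)) :=
    fun k => measurableSet_shell _ _
  have hreal : ∀ k : Fin n → ℕ, μ.real (shell K Finset.univ (k + fun _ => e)) =
      ((1 - (resCard K : ℝ)⁻¹) ^ n * ((resCard K : ℝ)⁻¹) ^ (n * e)) *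
        ((resCard K : ℝ)⁻¹) ^ (∑ j, k j) := by
    intro k
    rw [measureReal_shell μ hμ]
    simp only [Finset.card_univ, Fintype.card_fin, Pi.add_apply, Finset.sum_add_distrib,
      Finset.sum_const, smul_eq_mul, pow_add]
    ring
  have hi : ∀ k, IntegrableOn F (shell K Finset.univ (k + fun _ => e)) μ := fun k =>
    (integrableOn_const (C := val k) (measure_shell_lt_top μ hμ _ _).ne).congr_fun
      (fun x hx => (hF k x hx).symm) (hmeas k)
  have hsum : Summable fun k => ∫ x in shell K Finset.univ (k + fun _ => e), ‖F x‖ ∂μ := by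
    refine (hs.mul_left ((1 - (resCard K : ℝ)⁻¹) ^ n * ((resCard K : ℝ)⁻¹) ^ (n * e))).congr
      fun k => ?_
    rw [setIntegral_congr_fun (hmeas k) fun x hx => congrArg norm (hF k x hx), setIntegral_const,
      hreal, smul_eq_mul]
    ring
  have hint := integrableOn_iUnion_of_summable_integral_norm hi hsum
  refine ⟨hint.congr_set_ae hae.symm, ?_⟩
  rw [setIntegral_congr_set hae.symm, integral_iUnion hmeas ?_ hint]
  · refine tsum_congr fun k => ?_
    rw [setIntegral_congr_fun (hmeas k) (hF k), setIntegral_const, hreal, Complex.real_smul]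
    push_cast
    ring
  · intro k k' hne
    refine Set.disjoint_left.2 fun x hx hx' => hne ?_
    ext j
    have h1 := (mem_shell_univ.1 hx j).2
    have h2 := (mem_shell_univ.1 hx' j).2
    simp only [Pi.add_apply] at h1 h2
    omega

end Measure

/-! ### Rational functions of `q ^ (-s)` and their poles. -/

section Rational

/-- `RatFunc.eval` uses the reduced fraction; its denominator divides `D`, hence does not vanish at
`z` either. -/
lemma ratFunc_eval_div {P D : Polynomial ℂ} {z : ℂ} (hz : D.eval z ≠ 0) :
    (algebraMap _ (RatFunc ℂ) P / algebraMap _ (RatFunc ℂ) D).eval (RingHom.id ℂ) z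
      = P.eval z / D.eval z := by
  have hD : D ≠ 0 := by rintro rfl; simp at hz
  set R := algebraMap _ (RatFunc ℂ) P / algebraMap _ (RatFunc ℂ) D with hR
  have hden : R.denom.eval z ≠ 0 := by
    obtain ⟨Q, hQ⟩ := RatFunc.denom_div_dvd P D
    rw [hQ, Polynomial.eval_mul] at hz
    exact left_ne_zero_of_mul hz
  have h := RatFunc.num_div_denom R
  have hD' : algebraMap (Polynomial ℂ) (RatFunc ℂ) D ≠ 0 := by
    simpa using hD
  have hden' : algebraMap (Polynomial ℂ) (RatFunc ℂ) R.denom ≠ 0 := by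
    simpa using R.denom_ne_zero
  have h2 : R.num * D = P * R.denom := by
    apply FaithfulSMul.algebraMap_injective (Polynomial ℂ) (RatFunc ℂ)
    rw [map_mul, map_mul]
    rw [hR, div_eq_div_iff hden' hD'] at h
    exact h
  have h3 := congrArg (Polynomial.eval z) h2
  rw [Polynomial.eval_mul, Polynomial.eval_mul] at h3
  simp only [RatFunc.eval, Polynomial.eval₂_id]
  rw [div_eq_div_iff hden hz, h3]

lemma analyticAt_polynomial_eval_cpow {q : ℂ} (hq : q ≠ 0) (P : Polynomial ℂ) (s : ℂ) :
    AnalyticAt ℂ (fun s : ℂ => P.eval (q ^ (-s))) s := by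
  have h : AnalyticAt ℂ (fun s : ℂ => q ^ (-s)) s := by
    simp only [Complex.cpow_def_of_ne_zero hq]
    fun_prop
  simpa using h.aeval_polynomial P

lemma meromorphic_ratFunc_eval_cpow {q : ℂ} (hq : q ≠ 0) (R : RatFunc ℂ) :
    Meromorphic fun s : ℂ => R.eval (RingHom.id ℂ) (q ^ (-s)) := by
  intro s
  simp only [RatFunc.eval, Polynomial.eval₂_id]
  exact (analyticAt_polynomial_eval_cpow hq _ s).meromorphicAt.div
    (analyticAt_polynomial_eval_cpow hq _ s).meromorphicAt

lemma eval_eq_zero_of_isPole {q : ℂ} (hq : q ≠ 0) {P D : Polynomial ℂ} {s : ℂ}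
    (hs : IsPole (fun s : ℂ => (algebraMap _ (RatFunc ℂ) P / algebraMap _ (RatFunc ℂ) D).eval
      (RingHom.id ℂ) (q ^ (-s))) s) : D.eval (q ^ (-s)) = 0 := by
  by_contra h
  refine not_le.2 hs.2 (AnalyticAt.meromorphicOrderAt_nonneg ?_)
  have h1 := (analyticAt_polynomial_eval_cpow hq P s).div
    (analyticAt_polynomial_eval_cpow hq D s) h
  refine h1.congr ?_
  filter_upwards [(analyticAt_polynomial_eval_cpow hq D s).continuousAt.eventually_ne h] with z hz
  exact (ratFunc_eval_div hz).symm

lemma natCast_inv_pow_cpow {q : ℕ} (hq : 0 < q) (m : ℕ) (s : ℂ) :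
    ((((q : ℝ)⁻¹ ^ m : ℝ)) : ℂ) ^ s = ((q : ℂ) ^ (-s)) ^ m := by
  have hq0 : (q : ℂ) ≠ 0 := by exact_mod_cast hq.ne'
  have hpos : (0 : ℝ) < (q : ℝ)⁻¹ ^ m := by positivity
  rw [Complex.cpow_def_of_ne_zero (by exact_mod_cast hpos.ne'), Complex.cpow_def_of_ne_zero hq0,
    ← Complex.exp_nat_mul, ← Complex.ofReal_log hpos.le, Real.log_pow, Real.log_inv,
    ← Complex.natCast_log]
  push_cast
  congr 1
  ring

/-- Solving `q ^ (-A) * (q ^ (-s)) ^ m = 1` for `s`. -/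
lemma eq_of_inv_pow_mul_cpow_pow_eq_one {q : ℕ} (hq : 1 < q) {A m : ℕ} (hA : 0 < A) {s : ℂ}
    (h : ((q : ℂ)⁻¹) ^ A * ((q : ℂ) ^ (-s)) ^ m = 1) :
    m ≠ 0 ∧ ∃ k : ℤ, s = -(A : ℂ) / m +
      2 * (Real.pi : ℂ) * Complex.I * k / (m * (Real.log q : ℂ)) := by
  have hq0 : (q : ℂ) ≠ 0 := by exact_mod_cast (zero_lt_one.trans hq).ne'
  have hlog : 0 < Real.log q := Real.log_pos (by exact_mod_cast hq)
  have hlog' : (Real.log q : ℂ) ≠ 0 := by exact_mod_cast hlog.ne'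
  have e1 : ((q : ℂ)⁻¹) ^ A = Complex.exp (-(A * Real.log q)) := by
    rw [Complex.exp_neg, Complex.exp_nat_mul, ← Complex.ofReal_exp,
      Real.exp_log (by exact_mod_cast zero_lt_one.trans hq)]
    simp
  have e2 : ((q : ℂ) ^ (-s)) ^ m = Complex.exp (-(m * s * Real.log q)) := by
    rw [Complex.cpow_def_of_ne_zero hq0, ← Complex.exp_nat_mul, Complex.natCast_log]
    congr 1
    ring
  rw [e1, e2, ← Complex.exp_add, Complex.exp_eq_one_iff] at h
  obtain ⟨k, hk⟩ := h
  clear e1 e2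
  generalize Real.log q = L at *
  -- For `m = 0` the left side of `hk` is the real number `-A * L`, which is negative, while the
  -- right side is purely imaginary.
  have hm : m ≠ 0 := by
    rintro rfl
    have hre := congrArg Complex.re hk
    simp at hre
    rcases hre with h | h
    · omega
    · exact hlog.ne' h
  have hm' : (m : ℂ) ≠ 0 := by exact_mod_cast hm
  refine ⟨hm, -k, ?_⟩
  field_simp
  push_cast
  linear_combination -hk

end Rational

/-! ### Cutting the orthant by the dominant monomial. -/

section Pieces

variable {n l : ℕ}

/-- The lattice points `k` at which `i` is the first index with `G i + ⟨N i, k⟩` minimal. -/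
def piece (N : Fin l → Fin n → ℕ) (G : Fin l → ℕ) (i : Fin l) : Set (Fin n → ℕ) :=
  latticePoints (fun i' j => (N i' j : ℤ) - N i j)
    (fun i' => (G i' : ℤ) - G i - if i' < i then 1 else 0)

/-- Over the integers, lowering the constant term by one makes an inequality strict. Ties thus go to
the smallest index without changing the recession cone. -/
lemma mem_piece {N : Fin l → Fin n → ℕ} {G : Fin l → ℕ} {i : Fin l} {k : Fin n → ℕ} :
    k ∈ piece N G i ↔ ∀ i', G i + ∑ j, N i j * k j ≤ G i' + ∑ j, N i' j * k j ∧
      (i' < i → G i + ∑ j, N i j * k j < G i' + ∑ j, N i' j * k j) := by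
  refine forall_congr' fun i' => ?_
  have h1 : ∑ j, ((N i' j : ℤ) - N i j) * (k j : ℤ) =
      ((∑ j, N i' j * k j : ℕ) : ℤ) - ((∑ j, N i j * k j : ℕ) : ℤ) := by
    push_cast
    rw [← Finset.sum_sub_distrib]
    exact Finset.sum_congr rfl fun j _ => by ring
  simp only [h1]
  generalize ∑ j, N i' j * k j = x
  generalize ∑ j, N i j * k j = y
  split_ifs with h
  · simp only [h, forall_const]
    omega
  · simp only [h, false_imp_iff, and_true]
    omega

/-- Every lattice point lies in exactly one piece. -/
lemma exists_forall_mem_piece_iff (hl : 1 ≤ l) (N : Fin l → Fin n → ℕ) (G : Fin l → ℕ)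
    (k : Fin n → ℕ) : ∃ i, ∀ i', k ∈ piece N G i' ↔ i' = i := by
  have : Nonempty (Fin l) := ⟨⟨0, hl⟩⟩
  let L : Fin l → ℕ := fun i => G i + ∑ j, N i j * k j
  simp only [mem_piece]
  -- Minimizing the pair `(L i, i)` lexicographically selects the first minimizer of `L`.
  obtain ⟨i, -, hi⟩ := Finset.exists_min_image Finset.univ (fun i => toLex (L i, i))
    Finset.univ_nonempty
  have hi' : ∀ i', L i ≤ L i' ∧ (i' < i → L i < L i') := by
    intro i'
    have := hi i' (Finset.mem_univ _)
    rw [Prod.Lex.toLex_le_toLex] at this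
    simp only at this
    refine ⟨by rcases this with h | h <;> omega, fun hlt => ?_⟩
    rcases this with h | ⟨-, h⟩
    · exact h
    · exact absurd h (not_le.2 hlt)
  refine ⟨i, fun i' => ⟨fun h => ?_, fun h => h ▸ hi'⟩⟩
  rcases lt_trichotomy i' i with hlt | heq | hlt
  · exact absurd ((hi' i').2 hlt) (not_lt.2 (h i).1)
  · exact heq
  · exact absurd ((h i).2 hlt) (not_lt.2 (hi' i').1)

/-- Sums over a type partitioned into finitely many sets. -/
lemma tsum_eq_sum_tsum_of_partition {α ι : Type*} [Fintype ι] {S : ι → Set α}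
    (hS : ∀ x, ∃ i, ∀ i', x ∈ S i' ↔ i' = i) {f : α → ℂ} (hf : Summable f) :
    ∑' x, f x = ∑ i, ∑' x : S i, f x := by
  classical
  simp only [tsum_subtype]
  rw [← Summable.tsum_finsetSum fun i _ => hf.indicator (S i)]
  refine tsum_congr fun x => ?_
  obtain ⟨i, hi⟩ := hS x
  simp [Set.indicator, hi]

end Pieces

/-! ### The integrand on a shell. -/

section Integrand

variable {K : Type*} [Field K] [ValuativeRel K] [TopologicalSpace K]
  [IsNonarchimedeanLocalField K] {n l : ℕ}

lemma monom_ne_zero {k : Fin n → ℕ} {x : Fin n → K} (hx : x ∈ shell K Finset.univ k)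
    (M : Fin n → ℕ) : monom M x ≠ 0 :=
  Finset.prod_ne_zero_iff.2 fun j _ => pow_ne_zero _ (mem_shell_univ.1 hx j).1

lemma ord_monom {k : Fin n → ℕ} {x : Fin n → K} (hx : x ∈ shell K Finset.univ k)
    (M : Fin n → ℕ) : ord (monom M x) = ((∑ j, M j * k j : ℕ) : ℤ) := by
  rw [mem_shell_univ] at hx
  rw [monom, ord_prod _ fun j _ => pow_ne_zero _ (hx j).1]
  push_cast
  exact Finset.sum_congr rfl fun j _ => by rw [ord_pow, (hx j).2]

lemma integrand_of_mem_shell (N : Fin l → Fin n → ℕ) (v : Fin n → ℕ) (c : Fin l → 𝒪[K])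
    (hc : ∀ i, c i ≠ 0) (s : ℂ) {k : Fin n → ℕ} {x : Fin n → K}
    (hx : x ∈ shell K Finset.univ k) {i : Fin l}
    (hi : ∀ i', (ord (c i : K)).toNat + ∑ j, N i j * k j ≤
      (ord (c i' : K)).toNat + ∑ j, N i' j * k j) :
    integrand N v c s x = ((resCard K : ℂ) ^ (-s)) ^ ((ord (c i : K)).toNat + ∑ j, N i j * k j) *
      ((resCard K : ℂ)⁻¹) ^ (∑ j, v j * k j) := by
  have hq : 1 < resCard K := one_lt_resCard
  have habs : ∀ i', absK ((c i' : K) * monom (N i') x) =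
      ((resCard K : ℝ)⁻¹) ^ ((ord (c i' : K)).toNat + ∑ j, N i' j * k j) := by
    intro i'
    have hc0 : (c i' : K) ≠ 0 := by simpa using hc i'
    have h1 := Int.toNat_of_nonneg ((ord_nonneg_iff hc0).2 (c i').2)
    rw [absK_of_ne_zero (mul_ne_zero hc0 (monom_ne_zero hx _)), ord_mul hc0 (monom_ne_zero hx _),
      ord_monom hx, ← h1, ← Nat.cast_add, zpow_neg, zpow_natCast, inv_pow, Int.toNat_natCast]
  have hnorm : normK (fun i' => (c i' : K) * monom (N i') x) =
      ((resCard K : ℝ)⁻¹) ^ ((ord (c i : K)).toNat + ∑ j, N i j * k j) := by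
    have : Nonempty (Fin l) := ⟨i⟩
    simp only [normK, habs]
    refine le_antisymm (ciSup_le fun i' => ?_) (le_ciSup
      (f := fun i' => ((resCard K : ℝ)⁻¹) ^ ((ord (c i' : K)).toNat + ∑ j, N i' j * k j))
      (Set.finite_range _).bddAbove i)
    exact pow_le_pow_of_le_one (by positivity)
      (inv_le_one_of_one_le₀ (by exact_mod_cast hq.le)) (hi i')
  rw [integrand, hnorm, natCast_inv_pow_cpow (by omega), absK_of_ne_zero (monom_ne_zero hx _),
    ord_monom hx, zpow_neg, zpow_natCast, ← inv_pow]
  push_cast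
  rfl

end Integrand

/-- In the exponent `v j + 1`, `v j` comes from `|x ^ v|_K` and `1` from the measure of the shell;
the shift by `e` contributes only a constant. -/
lemma monomial_weight_eq {n : ℕ} (Q T : ℂ) (G e : ℕ) (M v k : Fin n → ℕ) :
    Q ^ (∑ j, k j) * (T ^ (G + ∑ j, M j * k j) * Q ^ (∑ j, v j * (k j + e))) =
      T ^ G * Q ^ (∑ j, v j * e) * wt (fun j => Q ^ (v j + 1) * T ^ M j) k := by
  have h : wt (fun j => Q ^ (v j + 1) * T ^ M j) k =
      Q ^ (∑ j, v j * k j) * Q ^ (∑ j, k j) * T ^ (∑ j, M j * k j) := by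
    simp only [wt, mul_pow, ← pow_mul, Finset.prod_mul_distrib, Finset.prod_pow_eq_pow_sum,
      one_mul, pow_add]
  rw [h]
  simp only [mul_add, Finset.sum_add_distrib, pow_add]
  ring

lemma wt_monomials_eq {n : ℕ} (Q T : ℂ) (M v a : Fin n → ℕ) :
    wt (fun j => Q ^ (v j + 1) * T ^ M j) a =
      Q ^ (∑ j, a j + ∑ j, v j * a j) * T ^ (∑ j, M j * a j) := by
  have := monomial_weight_eq Q T 0 0 M v a
  simp only [zero_add, add_zero, mul_zero, Finset.sum_const_zero, pow_zero, one_mul] at this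
  rw [← this, pow_add]
  ring

lemma norm_monomial_lt_one {Q T : ℂ} (hQ : ‖Q‖ < 1) (hT : ‖T‖ ≤ 1) (m M : ℕ) :
    ‖Q ^ (m + 1) * T ^ M‖ < 1 := by
  rw [norm_mul, norm_pow, norm_pow]
  have h1 : ‖Q‖ ^ (m + 1) < 1 := pow_lt_one₀ (norm_nonneg _) hQ (Nat.succ_ne_zero _)
  have h2 : ‖T‖ ^ M ≤ 1 := pow_le_one₀ (norm_nonneg _) hT
  exact (mul_le_of_le_one_right (by positivity) h2).trans_lt h1

/-! ### Assembly of the rational function and location of its poles. -/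

section Main

variable {K : Type*} [Field K] [ValuativeRel K] [TopologicalSpace K]
  [IsNonarchimedeanLocalField K] {n l : ℕ}

variable [MeasurableSpace K] [BorelSpace K]

/-- The monomial integral as a finite sum of generating series of lattice points. -/
theorem integral_eq_sum_tsum (hl : 1 ≤ l) (μ : Measure (Fin n → K)) [μ.IsAddHaarMeasure]
    (hμ : μ {x | ∀ j, x j ∈ 𝒪[K]} = 1) (N : Fin l → Fin n → ℕ) (v : Fin n → ℕ)
    (c : Fin l → 𝒪[K]) (hc : ∀ i, c i ≠ 0) (e : ℕ) {G : Fin l → ℕ}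
    (hG : ∀ i, G i = (ord (c i : K)).toNat + ∑ j, N i j * e) {Q T s : ℂ}
    (hQ : Q = (resCard K : ℂ)⁻¹) (hT : T = (resCard K : ℂ) ^ (-s)) (hQ1 : ‖Q‖ < 1)
    (hT1 : ‖T‖ ≤ 1) :
    IntegrableOn (integrand N v c s) (polydisc K n e) μ ∧
      ∫ x in polydisc K n e, integrand N v c s x ∂μ = ∑ i,
        ((1 - Q) ^ n * Q ^ (n * e)) * (T ^ G i * Q ^ (∑ j, v j * e)) *
          ∑' k : piece N G i, wt (fun j => Q ^ (v j + 1) * T ^ N i j) k := by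
  choose idx hidx using exists_forall_mem_piece_iff hl N G
  have hidx' : ∀ k, k ∈ piece N G (idx k) := fun k => (hidx k _).2 rfl
  let cst : Fin l → ℂ := fun i => T ^ G i * Q ^ (∑ j, v j * e)
  let w : Fin l → Fin n → ℂ := fun i j => Q ^ (v j + 1) * T ^ N i j
  let val : (Fin n → ℕ) → ℂ := fun k =>
    T ^ (G (idx k) + ∑ j, N (idx k) j * k j) * Q ^ (∑ j, v j * (k j + e))
  have hterm : ∀ k, Q ^ (∑ j, k j) * val k = cst (idx k) * wt (w (idx k)) k := fun k =>
    monomial_weight_eq _ _ _ _ _ _ _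
  have hw : ∀ i j, ‖w i j‖ < 1 := fun i j => norm_monomial_lt_one hQ1 hT1 _ _
  have hsum : Summable fun k => ‖Q ^ (∑ j, k j) * val k‖ := by
    -- The index `idx k` varies with `k`, so each term is bounded by the sum over all `i`.
    have h1 : Summable fun k : Fin n → ℕ => ∑ i, ‖cst i * wt (w i) k‖ :=
      summable_sum fun i _ => by
        simpa only [norm_mul] using (summable_norm_wt (w i) (hw i)).mul_left ‖cst i‖
    refine h1.of_nonneg_of_le (fun _ => norm_nonneg _) fun k => ?_
    rw [hterm]
    exact Finset.single_le_sum (f := fun i => ‖cst i * wt (w i) k‖) (fun i _ => norm_nonneg _)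
      (Finset.mem_univ (idx k))
  have hF : ∀ k, ∀ x ∈ shell K Finset.univ (k + fun _ => e), integrand N v c s x = val k := by
    intro k x hx
    have hL : ∀ i, (ord (c i : K)).toNat + ∑ j, N i j * (k + fun _ => e : Fin n → ℕ) j =
        G i + ∑ j, N i j * k j := fun i => by
      simp only [hG, Pi.add_apply, mul_add, Finset.sum_add_distrib]
      ring
    rw [integrand_of_mem_shell N v c hc s hx (i := idx k)
      fun i' => by simpa only [hL] using (mem_piece.1 (hidx' k) i').1, hL, ← hT, ← hQ]
    rfl
  have hQn : ‖Q‖ = (resCard K : ℝ)⁻¹ := by rw [hQ]; simp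
  obtain ⟨h1, h2⟩ := integral_polydisc μ hμ hF (by
    simpa only [norm_mul, norm_pow, hQn] using hsum)
  refine ⟨h1, ?_⟩
  rw [h2, ← hQ, tsum_mul_left, tsum_eq_sum_tsum_of_partition (S := piece N G)
    (fun k => ⟨idx k, hidx k⟩) hsum.of_norm, Finset.mul_sum]
  refine Finset.sum_congr rfl fun i _ => ?_
  rw [mul_assoc ((1 - Q) ^ n * Q ^ (n * e)), ← tsum_mul_left (a := T ^ G i * Q ^ (∑ j, v j * e))]
  congr 1
  refine tsum_congr fun k => ?_
  have : i = idx k := (hidx k i).1 k.2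
  rw [hterm, ← this]

end Main

end MonomialIntegral

open MonomialIntegral in
theorem lemma3p1 {K : Type*} [Field K] [ValuativeRel K] [TopologicalSpace K]
    [IsNonarchimedeanLocalField K] [MeasurableSpace K] [BorelSpace K]
    {n l : ℕ} (hl : 1 ≤ l)
    (μ : Measure (Fin n → K)) [μ.IsAddHaarMeasure]
    (hμ : μ {x | ∀ j, x j ∈ 𝒪[K]} = 1)
    (N : Fin l → Fin n → ℕ) (hN : ∀ i, N i ≠ 0) (v : Fin n → ℕ)
    (c : Fin l → 𝒪[K]) (hc : ∀ i, c i ≠ 0) (e₀ : ℕ) :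
    ∃ R : RatFunc ℂ,
      (∀ s : ℂ, 0 < s.re →
        IntegrableOn (MonomialIntegral.integrand N v c s) (MonomialIntegral.polydisc K n e₀) μ ∧
        ∫ x in MonomialIntegral.polydisc K n e₀, MonomialIntegral.integrand N v c s x ∂μ
          = R.eval (RingHom.id ℂ) ((MonomialIntegral.resCard K : ℂ) ^ (-s))) ∧
      Meromorphic (fun s : ℂ => R.eval (RingHom.id ℂ) ((MonomialIntegral.resCard K : ℂ) ^ (-s))) ∧
      ∀ s : ℂ,
        MonomialIntegral.IsPole
          (fun s : ℂ => R.eval (RingHom.id ℂ) ((MonomialIntegral.resCard K : ℂ) ^ (-s))) s →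
        ∃ (γ : Set (Fin n → ℝ)) (a : Fin n → ℕ) (m : ℝ) (k : ℤ),
          MonomialIntegral.IsFacet (MonomialIntegral.newtonPolyhedron (Set.range N)) γ ∧
          MonomialIntegral.IsPrimitiveNormal γ a ∧
          m = MonomialIntegral.supportMin (MonomialIntegral.newtonPolyhedron (Set.range N))
            (fun j => (a j : ℝ)) ∧
          γ = {x ∈ MonomialIntegral.newtonPolyhedron (Set.range N) |
            (fun j => (a j : ℝ)) ⬝ᵥ x = m} ∧
          m ≠ 0 ∧
          s = -(((∑ j, a j : ℕ) : ℂ) + ((∑ j, v j * a j : ℕ) : ℂ)) / (m : ℂ)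
            + 2 * (Real.pi : ℂ) * Complex.I * (k : ℂ)
              / ((m : ℂ) * (Real.log (MonomialIntegral.resCard K) : ℂ)) := by
  have hq : 1 < resCard K := one_lt_resCard
  have hq0 : (resCard K : ℂ) ≠ 0 := by exact_mod_cast (zero_lt_one.trans hq).ne'
  obtain ⟨Q, hQ⟩ : ∃ Q : ℂ, Q = (resCard K : ℂ)⁻¹ := ⟨_, rfl⟩
  have hQ1 : ‖Q‖ < 1 := by
    rw [hQ, norm_inv, Complex.norm_natCast]
    exact inv_lt_one_of_one_lt₀ (by exact_mod_cast hq)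
  obtain ⟨G, hG⟩ : ∃ G : Fin l → ℕ, ∀ i, G i = (ord (c i : K)).toNat + ∑ j, N i j * e₀ :=
    ⟨_, fun _ => rfl⟩
  choose R a p ha hp using fun i => exists_polynomial_latticePoints
    (fun i' j => (N i' j : ℤ) - N i j) (fun i' => (G i' : ℤ) - G i - if i' < i then 1 else 0)
  let W : Fin l → Fin n → Polynomial ℂ := fun i j =>
    Polynomial.C (Q ^ (v j + 1)) * Polynomial.X ^ N i j
  let D : Fin l → Polynomial ℂ := fun i => ∏ r, (1 - ∏ j, W i j ^ a i r j)
  let P : Fin l → Polynomial ℂ := fun i =>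
    Polynomial.C ((1 - Q) ^ n * Q ^ (n * e₀) * Q ^ (∑ j, v j * e₀)) * Polynomial.X ^ G i *
      MvPolynomial.aeval (W i) (p i)
  have hDeval : ∀ i T, (D i).eval T =
      ∏ r, (1 - wt (fun j => Q ^ (v j + 1) * T ^ N i j) (a i r)) := by
    intro i T
    simp [D, W, wt, Polynomial.eval_prod]
  have hWeval : ∀ i T, (MvPolynomial.aeval (W i) (p i)).eval T =
      MvPolynomial.eval (fun j => Q ^ (v j + 1) * T ^ N i j) (p i) := by
    intro i T
    have h1 : ((Polynomial.evalRingHom T).comp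
        (MvPolynomial.aeval (R := ℂ) (W i)).toRingHom) =
        MvPolynomial.eval (fun j => Q ^ (v j + 1) * T ^ N i j) := by
      ext <;> simp [W]
    exact DFunLike.congr_fun h1 (p i)
  -- No denominator vanishes for `‖T‖ ≤ 1`, so the fraction may be evaluated naively wherever `0 <
  -- s.re`.
  have hD0 : ∀ i T, ‖T‖ ≤ 1 → (D i).eval T ≠ 0 := by
    intro i T hT
    rw [hDeval]
    refine Finset.prod_ne_zero_iff.2 fun r _ h => ?_
    have h1 := norm_wt_lt_one (fun j => norm_monomial_lt_one hQ1 hT (v j) (N i j))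
      (ne_zero_of_gcd_eq_one (ha i r).gcd_eq_one)
    rw [← sub_eq_zero.1 h, norm_one] at h1
    exact lt_irrefl _ h1
  -- The fraction over the common denominator need not be reduced: cancellation can only remove
  -- poles.
  refine ⟨algebraMap _ (RatFunc ℂ) (∑ i, P i * ∏ i' ∈ Finset.univ.erase i, D i') /
    algebraMap _ (RatFunc ℂ) (∏ i, D i), ?_, meromorphic_ratFunc_eval_cpow hq0 _, ?_⟩
  · intro s hs
    obtain ⟨T, hT⟩ : ∃ T : ℂ, T = (resCard K : ℂ) ^ (-s) := ⟨_, rfl⟩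
    have hT1 : ‖T‖ ≤ 1 := by
      rw [hT, Complex.norm_natCast_cpow_of_pos (by omega), Complex.neg_re]
      exact Real.rpow_le_one_of_one_le_of_nonpos (by exact_mod_cast hq.le) (by linarith)
    obtain ⟨h1, h2⟩ := integral_eq_sum_tsum hl μ hμ N v c hc e₀ hG hQ hT hQ1 hT1
    refine ⟨h1, ?_⟩
    have hDT : (∏ i, D i).eval T ≠ 0 := by
      rw [Polynomial.eval_prod]
      exact Finset.prod_ne_zero_iff.2 fun i _ => hD0 i T hT1
    rw [h2, ← hT, ratFunc_eval_div hDT, eq_div_iff hDT, Finset.sum_mul, Polynomial.eval_finsetSum]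
    refine Finset.sum_congr rfl fun i _ => ?_
    have h3 := hp i _ fun j => norm_monomial_lt_one hQ1 hT1 (v j) (N i j)
    rw [← hDeval i T, ← hWeval] at h3
    rw [← Finset.mul_prod_erase _ _ (Finset.mem_univ i), Polynomial.eval_mul, Polynomial.eval_mul,
      Polynomial.eval_mul, Polynomial.eval_mul, ← h3, Polynomial.eval_C, Polynomial.eval_pow,
      Polynomial.eval_X, piece]
    ring
  · intro s hs
    have h1 := eval_eq_zero_of_isPole hq0 hs
    rw [Polynomial.eval_prod, Finset.prod_eq_zero_iff] at h1
    obtain ⟨i, -, h1⟩ := h1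
    rw [hDeval, Finset.prod_eq_zero_iff] at h1
    obtain ⟨r, -, h1⟩ := h1
    have hray := ha i r
    generalize a i r = b at h1 hray
    rw [sub_eq_zero, eq_comm, wt_monomials_eq, hQ] at h1
    have hA : 0 < ∑ j, b j + ∑ j, v j * b j := by
      obtain ⟨j, hj⟩ := Function.ne_iff.1 (ne_zero_of_gcd_eq_one hray.gcd_eq_one)
      have := Finset.single_le_sum (f := b) (fun _ _ => Nat.zero_le _) (Finset.mem_univ j)
      have : b j ≠ 0 := hj
      omega
    obtain ⟨hm, k, hk⟩ := eq_of_inv_pow_mul_cpow_pow_eq_one hq hA h1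
    have hmin : supportMin (newtonPolyhedron (Set.range N)) (fun j => (b j : ℝ)) =
        ((∑ j, N i j * b j : ℕ) : ℝ) := by
      rw [supportMin_of_isRay hray]
      push_cast
      exact Finset.sum_congr rfl fun j _ => mul_comm _ _
    refine ⟨_, b, _, k, isFacet_of_isRay hray, isPrimitiveNormal_of_isRay hray _, rfl, rfl, ?_, ?_⟩
    · rw [hmin]
      exact_mod_cast hm
    · rw [hmin, Complex.ofReal_natCast, ← Nat.cast_add]
      exact hk
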